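/- Write $\hat u(\xi)=\int_{\mathbb R}u(x)e^{-i\xi x}\,dx$ and $\|u\|_{H^\sigma}=\big(\int_{\mathbb R}(1+\xi^2)^{\sigma}|\hat u(\xi)|^2d\xi\big)^{1/2}$ for the norm of $H^\sigma=H^\sigma(\mathbb R)$. Let $\beta$ be a kernel whose Fourier transform is a measurable function with $0\le\hat\beta(\xi)\le B$ for all $\xi\in\mathbb R$, and let $K$ be the operator $Ku=\mathcal F^{-1}\big(\hat\beta(\xi)^{1/2}\,\hat u(\xi)\big)$. Let $s>3/2$, $T>0$, $X^s=C([0,T],H^s)$ with $\|f\|_{X^s}=\sup_{0\le t\le T}\|f(t)\|_{H^s}$, and $Y^{s,s-1}=C([0,T],H^s)\cap C^1([0,T],H^{s-1})$ with $\|w\|_{Y^{s,s-1}}=\sup_{0\le t\le T}\|w(t)\|_{H^s}+\sup_{0\le t\le T}\|w_t(t)\|_{H^{s-1}}$. Let $u_0,v_0\in H^s$, let $w\in Y^{s,s-1}$ be real-valued with $0<c_1\le 1+w(x,t)$ for all $(x,t)\in\mathbb R\times[0,T]$, and let $F_1,F_2\in X^s$. Suppose that $u,v\in X^s$ satisfy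 the inhomogeneous linear system $$u_t=Kv_x+F_1,\qquad u(x,0)=u_0(x),$$ $$v_t=K\big((1+w)u_x\big)+F_2+G,\qquad v(x,0)=v_0(x)$$ on $\mathbb R\times[0,T]$ (the time derivatives being taken in $H^{s-1}$), where $G(t)\in H^s$ and $\|G(t)\|_{H^s}\le A\|u(t)\|_{H^s}$ for $0\le t\le T$. Then $$\|u(t)\|_{H^s}+\|v(t)\|_{H^s}\le C\big(\|u_0\|_{H^s}+\|v_0\|_{H^s}\big)e^{Ct}+C\big(\|F_1\|_{X^s}+\|F_2\|_{X^s}\big)\big(e^{Ct}-1\big),\qquad 0\le t\le T,$$ where $C>0$ depends only on $s$, $c_1$, $B$, $A$ and (an upper bound for) $\|w\|_{Y^{s,s-1}}$. -/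

import Mathlib

open MeasureTheory Filter Topology Set
open scoped FourierTransform SchwartzMap

namespace NonlocalWave

noncomputable section

/-- The space `L²(ℝ; ℂ)`. For `s ≥ 0` the Sobolev space `H^s(ℝ)` is a subspace of it. -/
abbrev L2 : Type := Lp ℂ 2 (volume : Measure ℝ)

/-- The Fourier transform in the normalization `û(ξ) = ∫ u(x) e^{-iξx} dx`, extended to `L²` by
Plancherel. Mathlib's transform is `𝓕 u (η) = ∫ u(x) e^{-2πiηx} dx`, so `û(ξ) = 𝓕 u (ξ / 2π)`. -/
def fhat (f : L2) (ξ : ℝ) : ℂ := (𝓕 f : L2) (ξ / (2 * Real.pi))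

/-- `f ∈ H^s(ℝ)` (for `s ≥ 0`): `∫ (1 + ξ²)^s |f̂(ξ)|² dξ < ∞`. -/
def MemHs (s : ℝ) (f : L2) : Prop :=
  Integrable (fun ξ : ℝ => (1 + ξ ^ 2) ^ s * ‖fhat f ξ‖ ^ 2)

/-- `‖f‖_{H^s} = (∫ (1 + ξ²)^s |f̂(ξ)|² dξ)^{1/2}`, meaningful for `f ∈ H^s`. -/
def hsNorm (s : ℝ) (f : L2) : ℝ :=
  Real.sqrt (∫ ξ : ℝ, (1 + ξ ^ 2) ^ s * ‖fhat f ξ‖ ^ 2)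

open Classical in
/-- The pointwise product `a f`, as an element of `L²`; it is used only where `a f ∈ L²`, and has
the default value `0` otherwise. -/
def mulL2 (a : ℝ → ℂ) (f : L2) : L2 :=
  if h : MemLp (fun x => a x * f x) 2 volume then h.toLp _ else 0

/-- The Fourier multiplier `f ↦ F⁻¹(m(ξ) f̂(ξ))`; the substitution `ξ = 2πη` is due to the
normalization of Mathlib's transform, see `fhat_fourierMult`. -/
def fourierMult (m : ℝ → ℂ) (f : L2) : L2 :=
  𝓕⁻ (mulL2 (fun η => m (2 * Real.pi * η)) (𝓕 f : L2))

/-- The multiplier with symbol `m` acts as multiplication by `m` on the transform `û`. -/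
theorem fhat_fourierMult (m : ℝ → ℂ) (f : L2)
    (h : MemLp (fun η => m (2 * Real.pi * η) * (𝓕 f : L2) η) 2 volume) :
    fhat (fourierMult m f) =ᵐ[volume] fun ξ => m ξ * fhat f ξ := by
  have h1 : (𝓕 (fourierMult m f) : L2) =ᵐ[volume]
      fun η => m (2 * Real.pi * η) * (𝓕 f : L2) η := by
    have e : (𝓕 (fourierMult m f) : L2) = h.toLp _ := by
      simp [fourierMult, mulL2, h]
    rw [e]
    exact h.coeFn_toLp
  have hq : Measure.QuasiMeasurePreserving (fun ξ : ℝ => ξ / (2 * Real.pi)) volume volume := by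
    refine ⟨by fun_prop, ?_⟩
    have hc : (2 * Real.pi)⁻¹ ≠ 0 := inv_ne_zero (by positivity)
    have := Real.map_volume_mul_right hc
    simp only [div_eq_mul_inv]
    rw [this]
    exact Measure.smul_absolutelyContinuous
  have h2 := hq.ae_eq_comp h1
  filter_upwards [h2] with ξ hξ
  have hp : 2 * Real.pi * (ξ / (2 * Real.pi)) = ξ := by
    have := Real.pi_pos
    field_simp
  simp only [Function.comp_apply, hp] at hξ
  simpa [fhat] using hξ

/-- The derivative `D_x f`, i.e. the multiplier with symbol `iξ`, for `f ∈ H^1`. -/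
def Dx (f : L2) : L2 := fourierMult (fun ξ => Complex.I * (ξ : ℂ)) f

/-- The operator `K f = F⁻¹(k(ξ) f̂(ξ))` with `k = b^{1/2}`, where `b` is the Fourier transform
`β̂` of the kernel. -/
def K (b : ℝ → ℝ) (f : L2) : L2 := fourierMult (fun ξ => (Real.sqrt (b ξ) : ℂ)) f

/-- The kernel `β`, a tempered distribution, has as Fourier transform the function `b = β̂`, in the
normalization `β̂(ξ) = ∫ β(x) e^{-iξx} dx`. -/
def HasFourierTransform (β : 𝓢'(ℝ, ℂ)) (b : ℝ → ℝ) : Prop :=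
  ∀ φ : 𝓢(ℝ, ℂ), (𝓕 β) φ = ∫ η : ℝ, (b (2 * Real.pi * η) : ℂ) * φ η

/-- `f ∈ X^s = C([0,T], H^s)`. -/
def MemX (s T : ℝ) (f : ℝ → L2) : Prop :=
  (∀ t ∈ Icc 0 T, MemHs s (f t)) ∧
  ∀ t ∈ Icc 0 T, Tendsto (fun τ => hsNorm s (f τ - f t)) (𝓝[Icc 0 T] t) (𝓝 0)

/-- `‖f‖_{X^s} = sup_{0 ≤ t ≤ T} ‖f(t)‖_{H^s}`. -/
def xNorm (s T : ℝ) (f : ℝ → L2) : ℝ :=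
  sSup ((fun t => hsNorm s (f t)) '' Icc 0 T)

/-- At every `t ∈ [0,T]` the map `f` has the derivative `f'(t)` in `H^σ` (one-sided at the end
points). The difference quotients are required to lie in `H^σ`. -/
def HasTimeDeriv (σ T : ℝ) (f f' : ℝ → L2) : Prop :=
  (∀ t ∈ Icc 0 T, MemHs σ (f t) ∧ MemHs σ (f' t)) ∧
  ∀ t ∈ Icc 0 T, Tendsto (fun τ => hsNorm σ ((τ - t)⁻¹ • (f τ - f t) - f' t))
    (𝓝[Icc 0 T \ {t}] t) (𝓝 0)

/-- `w ∈ Y^{s₁,s₂} = C([0,T], H^{s₁}) ∩ C¹([0,T], H^{s₂})`, with time derivative `w'`. -/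
def MemY (s₁ s₂ T : ℝ) (w w' : ℝ → L2) : Prop :=
  MemX s₁ T w ∧ HasTimeDeriv s₂ T w w' ∧ MemX s₂ T w'

/-- `‖w‖_{Y^{s₁,s₂}} = sup ‖w(t)‖_{H^{s₁}} + sup ‖w_t(t)‖_{H^{s₂}}`, where `w' = w_t`. -/
def yNorm (s₁ s₂ T : ℝ) (w w' : ℝ → L2) : ℝ := xNorm s₁ T w + xNorm s₂ T w'

end

end NonlocalWave

namespace NonlocalWave

/-! This is an energy estimate with the symmetrizer `1 + w`. Let P be the multiplier with symbol `(1
+ ξ²)^{s/2}` and E = ∫ (1 + w)|Pu|² + ∫ |Pv|², which is comparable to the squared `H^s` norms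
because `1 + w` is bounded below and, by Sobolev embedding, above. In dE/dt the top-order terms are
of two kinds. Those without `w` cancel, since `K` and P have real symbols and `Dx` an imaginary one
(`inner_add_inner_eq_zero`). Those with `w` add up to the pairing of P(w u_x) - (w P u)_x with K P v
(`norm_inner_add_inner_le`). This expression loses no derivative: its kernel on the Fourier side is
p(ξ)η - ξp(η), bounded by weights of order 1 and s split between η and ξ - η
(`IsTruncWt.symbol_le`). Young's inequality L¹ * L² → L² then gives the bound, the L¹ factor coming
from `s - 1 > 1/2` (`eLpNorm_brk_le`).

Since `u_t` and `v_t` exist only in `H^{s-1}`, E itself need not be differentiable. So P is replaced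
by the bounded multiplier with symbol `min (wt s) n`. Truncation is 1-Lipschitz, hence the symbol
bound is uniform in n. The truncated energy is differentiated in `L²` and integrated in time
(`energy_integral_le`), and n → ∞ recovers the full norms (`tendsto_norm_mop`). What remains is an
integral inequality for the square of y = ‖u‖ + ‖v‖, closed by `gronwall_sq`, which yields a bound
linear in the data. -/

/-! ### Fourier integrals on `L²` and Young's inequality. -/

/-- On `L¹ ∩ L²` the inverse Fourier transform of `L²` is given by the Fourier integral. -/
theorem fourierInv_toLp_ae_eq {g : ℝ → ℂ} (hg : Integrable g) (hg2 : MemLp g 2 volume) :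
    ((𝓕⁻ (hg2.toLp g) : L2) : ℝ → ℂ) =ᵐ[volume] 𝓕⁻ g := by
  have hcont : Continuous (𝓕⁻ g) := by
    rw [show 𝓕⁻ g = fun v => 𝓕 g (-v) from funext fun v => Real.fourierInv_eq_fourier_neg g v]
    exact (VectorFourier.fourierIntegral_continuous Real.continuous_fourierChar
      (L := innerₗ ℝ) continuous_inner hg).comp continuous_neg
  -- Both sides are compared against test functions: the `L²` transform agrees with that of tempered
  -- distributions, and the Fourier integral obeys the multiplication formula.
  refine ae_eq_of_integral_contDiff_smul_eq
    ((Lp.memLp (𝓕⁻ (hg2.toLp g) : L2)).locallyIntegrable (by norm_num))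
    hcont.locallyIntegrable ?_
  intro φ hφ hφc
  have hc : HasCompactSupport (fun x => (φ x : ℂ)) := hφc.comp_left (g := fun y : ℝ => (y : ℂ)) (by simp)
  have hd : ContDiff ℝ ((⊤ : ℕ∞) : WithTop ℕ∞) (fun x => (φ x : ℂ)) := Complex.ofRealCLM.contDiff.comp hφ
  set Φ : 𝓢(ℝ, ℂ) := hc.toSchwartzMap hd with hΦ
  have hΦx : ∀ x, Φ x = (φ x : ℂ) := fun x => rfl
  have h1 : (Lp.toTemperedDistribution (𝓕⁻ (hg2.toLp g) : L2)) Φ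
      = (Lp.toTemperedDistribution (hg2.toLp g)) (𝓕⁻ Φ) := by
    rw [← Lp.fourierInv_toTemperedDistribution_eq, TemperedDistribution.fourierInv_apply]
  rw [Lp.toTemperedDistribution_apply, Lp.toTemperedDistribution_apply] at h1
  have h2 : ∫ x, (𝓕⁻ Φ) x • (hg2.toLp g : ℝ → ℂ) x = ∫ x, (𝓕⁻ Φ) x • g x := by
    refine integral_congr_ae ?_
    filter_upwards [hg2.coeFn_toLp] with x hx
    rw [hx]
  have h3 : ∫ x, Φ x • (𝓕⁻ g) x = ∫ x, (𝓕⁻ Φ) x • g x := by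
    -- With the form `-innerₗ ℝ` the general Fourier integral is the inverse transform.
    have hL : Continuous fun q : ℝ × ℝ => (-innerₗ ℝ : ℝ →ₗ[ℝ] ℝ →ₗ[ℝ] ℝ) q.1 q.2 :=
      continuous_inner.neg
    have h4 := VectorFourier.integral_fourierIntegral_smul_eq_flip (L := -innerₗ ℝ) (μ := volume)
      (ν := volume) (f := ⇑Φ) (g := g) Real.continuous_fourierChar hL Φ.integrable hg
    have h5 : ∀ (h : ℝ → ℂ) (x : ℝ),
        VectorFourier.fourierIntegral Real.fourierChar volume (-innerₗ ℝ) h x = 𝓕⁻ h x := by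
      intro h x
      simp [VectorFourier.fourierIntegral, Real.fourierInv_eq]
    have h6 : ∀ (h : ℝ → ℂ) (x : ℝ),
        VectorFourier.fourierIntegral Real.fourierChar volume (-innerₗ ℝ).flip h x = 𝓕⁻ h x := by
      intro h x
      simp [VectorFourier.fourierIntegral, Real.fourierInv_eq, mul_comm]
    simp only [h5, h6] at h4
    rw [SchwartzMap.fourierInv_coe]
    exact h4.symm
  calc ∫ x, φ x • (𝓕⁻ (hg2.toLp g) : L2) x
      = ∫ x, Φ x • (𝓕⁻ (hg2.toLp g) : L2) x := by simp [hΦx]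
    _ = ∫ x, Φ x • (𝓕⁻ g) x := by rw [h1, h2, h3]
    _ = _ := by simp [hΦx]

open scoped ENNReal in
/-- Young's inequality `L¹ * L² → L²` for nonnegative functions. -/
theorem eLpNorm_lconvolution_le {f g : ℝ → ℝ≥0∞} (hf : AEMeasurable f) (hg : AEMeasurable g) :
    eLpNorm (fun x => ∫⁻ y, f y * g (-y + x)) 2 volume ≤ (∫⁻ y, f y) * eLpNorm g 2 volume := by
  have hpt : ∀ x, (∫⁻ y, f y * g (-y + x)) ^ (2 : ℝ)
      ≤ (∫⁻ y, f y) * ∫⁻ y, f y * g (-y + x) ^ (2 : ℝ) := by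
    intro x
    have hgx : AEMeasurable (fun y => g (-y + x)) := by
      have : Measure.QuasiMeasurePreserving (fun y : ℝ => -y + x) volume volume := by
        have := (measurePreserving_add_right (volume : Measure ℝ) x).comp
          (Measure.measurePreserving_neg (volume : Measure ℝ))
        exact this.quasiMeasurePreserving
      exact hg.comp_quasiMeasurePreserving this
    -- Cauchy–Schwarz for the measure f dy, written by splitting f = f^{1/2} · f^{1/2}; Tonelli and
    -- translation invariance finish.
    have h := ENNReal.lintegral_mul_le_Lp_mul_Lq (volume : Measure ℝ) Real.HolderConjugate.two_two
      (f := fun y => f y ^ (1 / 2 : ℝ)) (g := fun y => f y ^ (1 / 2 : ℝ) * g (-y + x))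
      (hf.pow_const _) ((hf.pow_const _).mul hgx)
    have e1 : ∀ y, f y ^ (1 / 2 : ℝ) * (f y ^ (1 / 2 : ℝ) * g (-y + x)) = f y * g (-y + x) := by
      intro y
      rw [← mul_assoc, ← ENNReal.rpow_add_of_nonneg _ _ (by norm_num) (by norm_num)]
      norm_num
    have e2 : ∀ y, (f y ^ (1 / 2 : ℝ)) ^ (2 : ℝ) = f y := by
      intro y
      rw [← ENNReal.rpow_mul]; norm_num
    have e3 : ∀ y, (f y ^ (1 / 2 : ℝ) * g (-y + x)) ^ (2 : ℝ) = f y * g (-y + x) ^ (2 : ℝ) := by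
      intro y
      rw [ENNReal.mul_rpow_of_nonneg _ _ (by norm_num), e2]
    simp only [Pi.mul_apply, e1, e2, e3] at h
    calc _ ≤ ((∫⁻ y, f y) ^ (1 / 2 : ℝ) *
          (∫⁻ y, f y * g (-y + x) ^ (2 : ℝ)) ^ (1 / 2 : ℝ)) ^ (2 : ℝ) := by gcongr
      _ = _ := by
        rw [ENNReal.mul_rpow_of_nonneg _ _ (by norm_num), ← ENNReal.rpow_mul, ← ENNReal.rpow_mul]
        norm_num
  have hint : ∫⁻ x, (∫⁻ y, f y * g (-y + x)) ^ (2 : ℝ)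
      ≤ (∫⁻ y, f y) ^ (2 : ℝ) * ∫⁻ x, g x ^ (2 : ℝ) := by
    calc _ ≤ ∫⁻ x, (∫⁻ y, f y) * ∫⁻ y, f y * g (-y + x) ^ (2 : ℝ) := lintegral_mono hpt
      _ = (∫⁻ y, f y) * ∫⁻ x, ∫⁻ y, f y * g (-y + x) ^ (2 : ℝ) := by
        rw [lintegral_const_mul'']
        have := aemeasurable_lconvolution (μ := (volume : Measure ℝ)) hf (hg.pow_const (2 : ℝ))
        exact this
      _ = (∫⁻ y, f y) * ∫⁻ y, ∫⁻ x, f y * g (-y + x) ^ (2 : ℝ) := by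
        rw [lintegral_lintegral_swap]
        have : AEMeasurable (fun p : ℝ × ℝ => g (-p.2 + p.1)) (volume.prod volume) := by
          refine hg.comp_quasiMeasurePreserving (f := fun p : ℝ × ℝ => -p.2 + p.1) ?_
          have := quasiMeasurePreserving_sub (volume : Measure ℝ) (volume : Measure ℝ)
          convert this using 1
          ext p; simp [sub_eq_neg_add]
        exact (hf.comp_snd).mul (this.pow_const 2)
      _ = (∫⁻ y, f y) * ∫⁻ y, f y * ∫⁻ x, g x ^ (2 : ℝ) := by
        congr 1
        refine lintegral_congr fun y => ?_
        rw [lintegral_const_mul'']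
        · congr 1
          exact lintegral_add_left_eq_self (fun x => g x ^ (2 : ℝ)) (-y)
        · have := hg.comp_quasiMeasurePreserving
            (measurePreserving_add_left (volume : Measure ℝ) (-y)).quasiMeasurePreserving
          exact this.pow_const 2
      _ = _ := by
        rw [lintegral_mul_const'' _ hf, ← mul_assoc]
        congr 1
        rw [ENNReal.rpow_two, sq]
  rw [eLpNorm_eq_lintegral_rpow_enorm_toReal (by norm_num) (by norm_num),
    eLpNorm_eq_lintegral_rpow_enorm_toReal (by norm_num) (by norm_num)]
  simp only [enorm_eq_self, ENNReal.toReal_ofNat]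
  calc _ ≤ ((∫⁻ y, f y) ^ (2 : ℝ) * ∫⁻ x, g x ^ (2 : ℝ)) ^ (1 / 2 : ℝ) := by gcongr
    _ = _ := by
      rw [ENNReal.mul_rpow_of_nonneg _ _ (by norm_num), ← ENNReal.rpow_mul]
      norm_num

/-! ### Multiplication operators on `L²` and the transform of a product. -/

theorem mulL2_coeFn {a : ℝ → ℂ} {f : L2} (h : MemLp (fun x => a x * f x) 2 volume) :
    (mulL2 a f : ℝ → ℂ) =ᵐ[volume] fun x => a x * f x := by
  rw [mulL2, dif_pos h]
  exact h.coeFn_toLp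

/-- Measurable and essentially bounded by `C`. -/
def BddBy (a : ℝ → ℂ) (C : ℝ) : Prop :=
  AEStronglyMeasurable a volume ∧ ∀ᵐ x, ‖a x‖ ≤ C

theorem BddBy.memLp_mul {a : ℝ → ℂ} {C : ℝ} (ha : BddBy a C) (f : L2) :
    MemLp (fun x => a x * f x) 2 volume := by
  refine (Lp.memLp f).of_le_mul (c := C) (ha.1.mul (Lp.aestronglyMeasurable f)) ?_
  filter_upwards [ha.2] with x hx
  rw [norm_mul]; gcongr

theorem BddBy.norm_mulL2_le {a : ℝ → ℂ} {C : ℝ} (ha : BddBy a C) (f : L2) :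
    ‖mulL2 a f‖ ≤ C * ‖f‖ := by
  refine Lp.norm_le_mul_norm_of_ae_le_mul ?_
  filter_upwards [mulL2_coeFn (ha.memLp_mul f), ha.2] with x hx hC
  rw [hx, norm_mul]; gcongr

open Classical in
/-- Multiplication by an essentially bounded function, as an operator on `L²`. -/
noncomputable def mulCLM (a : ℝ → ℂ) : L2 →L[ℂ] L2 :=
  if h : ∃ C, BddBy a C then
    LinearMap.mkContinuousOfExistsBound
      { toFun := mulL2 a
        map_add' := fun f g => by
          obtain ⟨C, hC⟩ := h
          apply Lp.ext
          filter_upwards [mulL2_coeFn (hC.memLp_mul (f + g)), mulL2_coeFn (hC.memLp_mul f),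
            mulL2_coeFn (hC.memLp_mul g), Lp.coeFn_add f g,
            Lp.coeFn_add (mulL2 a f) (mulL2 a g)] with x h1 h2 h3 h4 h5
          rw [h1, h5, Pi.add_apply, h2, h3, h4, Pi.add_apply, mul_add]
        map_smul' := fun c f => by
          obtain ⟨C, hC⟩ := h
          apply Lp.ext
          filter_upwards [mulL2_coeFn (hC.memLp_mul (c • f)), mulL2_coeFn (hC.memLp_mul f),
            Lp.coeFn_smul c f, Lp.coeFn_smul c (mulL2 a f)] with x h1 h2 h3 h4
          simp [h1, h2, h3, h4, mul_left_comm] }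
      (h.imp fun _ hC f => hC.norm_mulL2_le f)
  else 0

theorem BddBy.mulCLM_apply {a : ℝ → ℂ} {C : ℝ} (ha : BddBy a C) (f : L2) :
    mulCLM a f = mulL2 a f := by
  rw [mulCLM, dif_pos ⟨C, ha⟩]; rfl

theorem BddBy.mulCLM_coeFn {a : ℝ → ℂ} {C : ℝ} (ha : BddBy a C) (f : L2) :
    (mulCLM a f : ℝ → ℂ) =ᵐ[volume] fun x => a x * f x := by
  rw [ha.mulCLM_apply]; exact mulL2_coeFn (ha.memLp_mul f)

theorem BddBy.norm_mulCLM_le {a : ℝ → ℂ} {C : ℝ} (ha : BddBy a C) (hC : 0 ≤ C) :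
    ‖mulCLM a‖ ≤ C :=
  ContinuousLinearMap.opNorm_le_bound _ hC fun f => by
    rw [ha.mulCLM_apply]; exact ha.norm_mulL2_le f

theorem inner_eq_integral (f g : L2) : inner ℂ f g = ∫ x, starRingEnd ℂ (f x) * g x := by
  rw [L2.inner_def]
  refine integral_congr_ae (Eventually.of_forall fun x => ?_)
  simp [RCLike.inner_apply, mul_comm]

/-- The transform of a product is the convolution of the transforms. -/
theorem fourier_mulL2_ae_eq {w f : L2} (hw : Integrable (𝓕 w : L2)) (hf : Integrable (𝓕 f : L2))
    {C : ℝ} (hb : BddBy w C) :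
    (𝓕 (mulL2 w f) : L2) =ᵐ[volume] fun ξ => ∫ t, (𝓕 f : L2) t * (𝓕 w : L2) (-t + ξ) := by
  set g : ℝ → ℂ := fun ξ => ∫ t, (𝓕 f : L2) t * (𝓕 w : L2) (-t + ξ) with hg
  have hgc : g = convolution (⇑(𝓕 f : L2)) (⇑(𝓕 w : L2)) (ContinuousLinearMap.mul ℂ ℂ) volume := by
    ext ξ
    simp [hg, convolution, sub_eq_neg_add]
  have hgi : Integrable g := by
    rw [hgc]; exact hf.integrable_convolution _ hw
  have hg2 : MemLp g 2 volume := by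
    refine ⟨hgi.1, lt_of_le_of_lt ?_ (ENNReal.mul_lt_top hf.2 (Lp.memLp (𝓕 w : L2)).2)⟩
    have := eLpNorm_lconvolution_le hf.1.enorm (Lp.memLp (𝓕 w : L2)).1.enorm
    rw [eLpNorm_enorm] at this
    refine le_trans (eLpNorm_mono_enorm fun x => ?_) this
    rw [enorm_eq_self]
    refine (enorm_integral_le_lintegral_enorm _).trans (lintegral_mono fun y => ?_)
    rw [enorm_mul]
  have key : ∀ h : L2, Integrable (𝓕 h : L2) → (h : ℝ → ℂ) =ᵐ[volume] 𝓕⁻ (⇑(𝓕 h : L2)) := by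
    intro h hh
    have := fourierInv_toLp_ae_eq hh (Lp.memLp _)
    rwa [Lp.toLp_coeFn, FourierTransform.fourierInv_fourier_eq] at this
  -- All three functions are inverse Fourier integrals almost everywhere, and at that level the
  -- convolution theorem holds at every point.
  have hprod : mulL2 w f = 𝓕⁻ (hg2.toLp g) := by
    apply Lp.ext
    filter_upwards [mulL2_coeFn (hb.memLp_mul f), key w hw, key f hf,
      fourierInv_toLp_ae_eq hgi hg2] with x h1 h2 h3 h4
    rw [h1, h2, h3, h4, hgc, Real.fourierInv_eq_fourier_neg, Real.fourierInv_eq_fourier_neg,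
      Real.fourierInv_eq_fourier_neg, Real.fourier_mul_convolution_eq hf hw, mul_comm]
  rw [hprod, FourierTransform.fourier_fourierInv_eq]
  exact hg2.coeFn_toLp

/-- By Fourier inversion `w` is an integral of its transform against characters of modulus one. -/
theorem bddBy_of_integrable_fourier {w : L2} (hw : Integrable (𝓕 w : L2)) :
    BddBy w (∫ ξ, ‖(𝓕 w : L2) ξ‖) := by
  refine ⟨Lp.aestronglyMeasurable w, ?_⟩
  have := fourierInv_toLp_ae_eq hw (Lp.memLp _)
  rw [Lp.toLp_coeFn, FourierTransform.fourierInv_fourier_eq] at this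
  filter_upwards [this] with x hx
  rw [hx, Real.fourierInv_eq]
  refine (norm_integral_le_integral_norm _).trans_eq ?_
  simp

/-! ### Sobolev weights and the norm of `H^s`. -/

/-- The weight `(1 + ξ²)^{s/2}` at `ξ = 2πη`. -/
noncomputable def wt (s η : ℝ) : ℝ := (1 + (2 * Real.pi * η) ^ 2) ^ (s / 2)

theorem one_le_base (η : ℝ) : 1 ≤ 1 + (2 * Real.pi * η) ^ 2 := by nlinarith [sq_nonneg (2 * Real.pi * η)]

theorem wt_pos (s η : ℝ) : 0 < wt s η := Real.rpow_pos_of_pos (by positivity) _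

theorem wt_mul_wt (a b η : ℝ) : wt a η * wt b η = wt (a + b) η := by
  rw [wt, wt, wt, ← Real.rpow_add (by positivity), add_div]

theorem wt_zero (η : ℝ) : wt 0 η = 1 := by simp [wt]

theorem wt_mono {a b : ℝ} (h : a ≤ b) (η : ℝ) : wt a η ≤ wt b η :=
  Real.rpow_le_rpow_of_exponent_le (one_le_base η) (by linarith)

theorem one_le_wt {s : ℝ} (hs : 0 ≤ s) (η : ℝ) : 1 ≤ wt s η := by
  rw [← wt_zero η]; exact wt_mono hs η

theorem continuous_wt (s : ℝ) : Continuous (wt s) := by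
  unfold wt
  refine Continuous.rpow_const (by fun_prop) fun x => Or.inl ?_
  positivity

theorem wt_sq (s η : ℝ) : wt s η ^ 2 = (1 + (2 * Real.pi * η) ^ 2) ^ s := by
  rw [sq, wt_mul_wt, wt]; congr 1; ring

theorem wt_rpow (s η : ℝ) : wt s η = wt 1 η ^ s := by
  rw [wt, wt, ← Real.rpow_mul (by positivity)]; congr 1; ring

theorem abs_le_wt_one (η : ℝ) : |2 * Real.pi * η| ≤ wt 1 η := by
  have := wt_sq 1 η
  rw [Real.rpow_one] at this
  exact abs_le_of_sq_le_sq (by rw [this]; linarith) (wt_pos 1 η).le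

theorem memLp_wt_neg {δ : ℝ} (hδ : 1 / 2 < δ) : MemLp (wt (-δ)) 2 volume := by
  rw [memLp_two_iff_integrable_sq (continuous_wt _).aestronglyMeasurable]
  have h := integrable_rpow_neg_one_add_norm_sq (E := ℝ) (μ := volume) (r := 2 * δ)
    (by simp; linarith)
  have h2 := h.comp_mul_left' (R := 2 * Real.pi) (by positivity)
  refine h2.congr (Eventually.of_forall fun η => ?_)
  simp only [wt_sq, Real.norm_eq_abs, sq_abs]
  congr 1; ring

/-- The function `(1 + ξ²)^{s/2} f̂(ξ)` in the variable `η = ξ / 2π`. -/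
noncomputable def wfun (s : ℝ) (f : L2) (η : ℝ) : ℂ := (wt s η : ℂ) * (𝓕 f : L2) η

theorem norm_wfun (s : ℝ) (f : L2) (η : ℝ) : ‖wfun s f η‖ = wt s η * ‖(𝓕 f : L2) η‖ := by
  rw [wfun, norm_mul, Complex.norm_real, Real.norm_of_nonneg (wt_pos s η).le]

theorem aestronglyMeasurable_wfun (s : ℝ) (f : L2) : AEStronglyMeasurable (wfun s f) volume :=
  (Complex.continuous_ofReal.comp (continuous_wt s)).aestronglyMeasurable.mul
    (Lp.aestronglyMeasurable _)

theorem memHs_iff (s : ℝ) (f : L2) : MemHs s f ↔ MemLp (wfun s f) 2 volume := by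
  rw [memLp_two_iff_integrable_sq_norm (aestronglyMeasurable_wfun s f), MemHs,
    ← integrable_comp_mul_left_iff _ (R := 2 * Real.pi) (by positivity)]
  refine integrable_congr (Eventually.of_forall fun η => ?_)
  have hp : 2 * Real.pi * η / (2 * Real.pi) = η := by field_simp
  simp only [fhat, hp, norm_wfun, mul_pow, wt_sq]

theorem hsNorm_sq (s : ℝ) (f : L2) : hsNorm s f ^ 2 = 2 * Real.pi * ∫ η, ‖wfun s f η‖ ^ 2 := by
  rw [hsNorm, Real.sq_sqrt (integral_nonneg fun ξ => by positivity)]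
  have := Measure.integral_comp_mul_left
    (fun ξ : ℝ => (1 + ξ ^ 2) ^ s * ‖fhat f ξ‖ ^ 2) (2 * Real.pi)
  have hp : ∀ η, 2 * Real.pi * η / (2 * Real.pi) = η := fun η => by field_simp
  rw [abs_of_pos (by positivity), smul_eq_mul, eq_inv_mul_iff_mul_eq₀ (by positivity)] at this
  rw [← this]
  congr 1
  refine integral_congr_ae (Eventually.of_forall fun η => ?_)
  simp only [fhat, hp, norm_wfun, mul_pow, wt_sq]

theorem hsNorm_nonneg (s : ℝ) (f : L2) : 0 ≤ hsNorm s f := Real.sqrt_nonneg _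

/-- The element `(1 + ξ²)^{s/2} f̂(ξ)` of `L²`. -/
noncomputable def wL2 (s : ℝ) (f : L2) : L2 := mulL2 (fun η => (wt s η : ℂ)) (𝓕 f : L2)

theorem MemHs.wL2_coeFn {s : ℝ} {f : L2} (h : MemHs s f) :
    (wL2 s f : ℝ → ℂ) =ᵐ[volume] wfun s f :=
  mulL2_coeFn ((memHs_iff s f).1 h)

theorem norm_sq_eq_integral (f : L2) : ‖f‖ ^ 2 = ∫ x, ‖f x‖ ^ 2 := by
  have := inner_eq_integral f f
  rw [inner_self_eq_norm_sq_to_K] at this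
  have h2 : (∫ x, starRingEnd ℂ (f x) * f x) = ((∫ x, ‖f x‖ ^ 2 : ℝ) : ℂ) := by
    rw [← integral_complex_ofReal]
    refine integral_congr_ae (Eventually.of_forall fun x => ?_)
    simp [Complex.conj_mul']
  rw [h2] at this
  apply Complex.ofReal_injective
  rw [← this, Complex.ofReal_pow]
  rfl

/-- The factor is the square root of the Jacobian of ξ = 2πη. -/
theorem MemHs.hsNorm_eq {s : ℝ} {f : L2} (h : MemHs s f) :
    hsNorm s f = Real.sqrt (2 * Real.pi) * ‖wL2 s f‖ := by
  have h1 : hsNorm s f ^ 2 = (Real.sqrt (2 * Real.pi) * ‖wL2 s f‖) ^ 2 := by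
    rw [hsNorm_sq, mul_pow, Real.sq_sqrt (by positivity), norm_sq_eq_integral]
    congr 1
    refine integral_congr_ae ?_
    filter_upwards [h.wL2_coeFn] with x hx
    rw [hx]
  exact (pow_left_inj₀ (hsNorm_nonneg s f) (by positivity) two_ne_zero).1 h1

theorem one_le_sqrt_two_pi : 1 ≤ Real.sqrt (2 * Real.pi) := by
  rw [Real.one_le_sqrt]; linarith [Real.pi_gt_three]

theorem MemHs.norm_wL2_le {s : ℝ} {f : L2} (h : MemHs s f) : ‖wL2 s f‖ ≤ hsNorm s f := by
  rw [h.hsNorm_eq]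
  exact le_mul_of_one_le_left (norm_nonneg _) one_le_sqrt_two_pi

theorem MemHs.norm_le {s : ℝ} {f : L2} (h : MemHs s f) (hs : 0 ≤ s) : ‖f‖ ≤ hsNorm s f := by
  refine le_trans ?_ h.norm_wL2_le
  rw [← Lp.norm_fourier_eq f]
  refine Lp.norm_le_norm_of_ae_le ?_
  filter_upwards [h.wL2_coeFn] with x hx
  rw [hx, norm_wfun]
  exact le_mul_of_one_le_left (norm_nonneg _) (one_le_wt hs x)

theorem wfun_add (s : ℝ) (f g : L2) : wfun s (f + g) =ᵐ[volume] wfun s f + wfun s g := by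
  filter_upwards [Lp.coeFn_add (𝓕 f : L2) (𝓕 g)] with x hx
  rw [Pi.add_apply, wfun, FourierTransform.fourier_add, hx, Pi.add_apply, mul_add]
  rfl

theorem wfun_smul (s : ℝ) (r : ℝ) (f : L2) : wfun s (r • f) =ᵐ[volume] (r : ℂ) • wfun s f := by
  have e : r • f = (r : ℂ) • f := by
    apply Lp.ext
    filter_upwards [Lp.coeFn_smul r f, Lp.coeFn_smul (r : ℂ) f] with x h1 h2
    rw [h1, h2, Pi.smul_apply, Pi.smul_apply, Complex.real_smul, smul_eq_mul]
  filter_upwards [Lp.coeFn_smul (r : ℂ) (𝓕 f : L2)] with x hx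
  rw [e, Pi.smul_apply, wfun, FourierTransform.fourier_smul, hx, Pi.smul_apply, wfun, smul_eq_mul,
    smul_eq_mul]
  ring

theorem MemHs.add {s : ℝ} {f g : L2} (hf : MemHs s f) (hg : MemHs s g) : MemHs s (f + g) := by
  rw [memHs_iff] at *
  exact (hf.add hg).ae_eq (wfun_add s f g).symm

theorem MemHs.smul {s : ℝ} {f : L2} (hf : MemHs s f) (r : ℝ) : MemHs s (r • f) := by
  rw [memHs_iff] at *
  exact (hf.const_smul (r : ℂ)).ae_eq (wfun_smul s r f).symm

theorem sub_eq_add_smul (f g : L2) : f - g = f + (-1 : ℝ) • g := by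
  rw [neg_one_smul, sub_eq_add_neg]

theorem MemHs.sub {s : ℝ} {f g : L2} (hf : MemHs s f) (hg : MemHs s g) : MemHs s (f - g) := by
  rw [sub_eq_add_smul]; exact hf.add (hg.smul _)

theorem hsNorm_add_le {s : ℝ} {f g : L2} (hf : MemHs s f) (hg : MemHs s g) :
    hsNorm s (f + g) ≤ hsNorm s f + hsNorm s g := by
  have e : wL2 s (f + g) = wL2 s f + wL2 s g := by
    apply Lp.ext
    filter_upwards [hf.wL2_coeFn, hg.wL2_coeFn, (hf.add hg).wL2_coeFn, wfun_add s f g,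
      Lp.coeFn_add (wL2 s f) (wL2 s g)] with x h1 h2 h3 h4 h5
    rw [h3, h4, h5, Pi.add_apply, Pi.add_apply, h1, h2]
  rw [hf.hsNorm_eq, hg.hsNorm_eq, (hf.add hg).hsNorm_eq, e, ← mul_add]
  gcongr
  exact norm_add_le _ _

theorem hsNorm_neg_one_smul {s : ℝ} {f : L2} : hsNorm s ((-1 : ℝ) • f) = hsNorm s f := by
  refine (pow_left_inj₀ (hsNorm_nonneg _ _) (hsNorm_nonneg _ _) two_ne_zero).1 ?_
  rw [hsNorm_sq, hsNorm_sq]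
  congr 1
  refine integral_congr_ae ?_
  filter_upwards [wfun_smul s (-1) f] with x hx
  rw [hx]; simp

theorem abs_hsNorm_sub_le {s : ℝ} {f g : L2} (hf : MemHs s f) (hg : MemHs s g) :
    |hsNorm s f - hsNorm s g| ≤ hsNorm s (f - g) := by
  have h1 := hsNorm_add_le (hf.sub hg) hg
  have h2 := hsNorm_add_le ((hf.sub hg).smul (-1)) hf
  rw [hsNorm_neg_one_smul] at h2
  rw [sub_add_cancel] at h1
  rw [neg_one_smul, neg_sub, sub_add_cancel] at h2
  rw [abs_le]; constructor <;> linarith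

/-! ### Integrability of transforms and Sobolev embedding. -/

/-- The norm of `(1 + ξ²)^{-δ/2}` in `L²`. -/
noncomputable def sobConst (δ : ℝ) : ℝ := (eLpNorm (wt (-δ)) 2 volume).toReal

theorem sobConst_nonneg (δ : ℝ) : 0 ≤ sobConst δ := ENNReal.toReal_nonneg

/-- Cauchy–Schwarz for `wt r = wt (-(σ - r)) * wt σ`, whose first factor is square integrable. The
case σ = s, r = 1 is where `3/2 < s` enters the commutator estimate. -/
theorem MemHs.lintegral_wfun_le {σ r : ℝ} {f : L2} (hf : MemHs σ f) (hr : 1 / 2 < σ - r) :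
    ∫⁻ η, ‖wfun r f η‖ₑ ≤ ENNReal.ofReal (sobConst (σ - r) * hsNorm σ f) := by
  have hm := (memHs_iff σ f).1 hf
  have hw := memLp_wt_neg hr
  have h := eLpNorm_smul_le_mul_eLpNorm (p := 2) (q := 2) (r := 1) hm.1 hw.1
  have e : (wt (-(σ - r)) • wfun σ f) = wfun r f := by
    ext η
    rw [Pi.smul_apply', wfun, wfun, Complex.real_smul, ← mul_assoc, ← Complex.ofReal_mul, wt_mul_wt]
    congr 3; ring
  rw [e, eLpNorm_one_eq_lintegral_enorm] at h
  refine h.trans ?_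
  rw [ENNReal.ofReal_mul (sobConst_nonneg _), sobConst, ENNReal.ofReal_toReal hw.2.ne]
  gcongr
  refine le_trans (le_of_eq ?_) (ENNReal.ofReal_le_ofReal hf.norm_wL2_le)
  rw [Lp.norm_def, ENNReal.ofReal_toReal (Lp.memLp _).2.ne]
  exact (eLpNorm_congr_ae hf.wL2_coeFn).symm

theorem MemHs.integrable_wfun {σ r : ℝ} {f : L2} (hf : MemHs σ f) (hr : 1 / 2 < σ - r) :
    Integrable (wfun r f) :=
  ⟨aestronglyMeasurable_wfun r f, lt_of_le_of_lt (hf.lintegral_wfun_le hr) ENNReal.ofReal_lt_top⟩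

theorem wfun_zero (f : L2) : wfun 0 f = (𝓕 f : L2) := by
  ext η; simp [wfun, wt_zero]

theorem MemHs.integrable_fourier {σ : ℝ} {f : L2} (hf : MemHs σ f) (hσ : 1 / 2 < σ) :
    Integrable (𝓕 f : L2) := by
  rw [← wfun_zero]; exact hf.integrable_wfun (by simpa using hσ)

/-- The Sobolev embedding `H^σ ⊂ L^∞` for `σ > 1/2`. -/
theorem MemHs.bddBy {σ : ℝ} {f : L2} (hf : MemHs σ f) (hσ : 1 / 2 < σ) :
    BddBy f (sobConst σ * hsNorm σ f) := by
  have h := bddBy_of_integrable_fourier (hf.integrable_fourier hσ)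
  refine ⟨h.1, h.2.mono fun x hx => hx.trans ?_⟩
  have h2 := hf.lintegral_wfun_le (r := 0) (by simpa using hσ)
  rw [wfun_zero, sub_zero] at h2
  rw [integral_norm_eq_lintegral_enorm (Lp.aestronglyMeasurable _)]
  exact ENNReal.toReal_le_of_le_ofReal (mul_nonneg (sobConst_nonneg _) (hsNorm_nonneg _ _)) h2

/-! ### The symbol estimate for truncated weights. -/

/-- For b ≤ a this is Bernoulli's inequality for (b/a)^s, multiplied by a^s. -/
theorem abs_rpow_sub_rpow_le {a b s : ℝ} (ha : 0 < a) (hb : 0 < b) (hs : 1 ≤ s) :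
    |a ^ s - b ^ s| ≤ s * max a b ^ (s - 1) * |a - b| := by
  wlog h : b ≤ a generalizing a b
  · rw [abs_sub_comm, max_comm, abs_sub_comm a b]
    exact this hb ha (le_of_not_ge h)
  rw [max_eq_left h, abs_of_nonneg (sub_nonneg.2 (Real.rpow_le_rpow hb.le h (by linarith))),
    abs_of_nonneg (sub_nonneg.2 h)]
  have hba : 0 < b / a := by positivity
  have h1 := one_add_mul_self_le_rpow_one_add (s := b / a - 1) (p := s) (by linarith) hs
  rw [add_sub_cancel, Real.div_rpow hb.le ha.le, le_div_iff₀ (by positivity)] at h1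
  have h2 : a ^ s = a ^ (s - 1) * a := by
    rw [Real.rpow_sub_one ha.ne']; field_simp
  have h3 : (1 + s * (b / a - 1)) * a ^ s = a ^ s + s * a ^ (s - 1) * (b - a) := by
    rw [h2]; field_simp
  rw [h3] at h1
  linarith

/-- Triangle inequality for the bracket (1 + ξ²)^{1/2}: after squaring, the cross term is controlled
by `abs_le_wt_one`. -/
theorem abs_wt_one_sub_le (x y : ℝ) : |wt 1 x - wt 1 y| ≤ wt 1 (x - y) := by
  have key : ∀ x y : ℝ, wt 1 x ≤ wt 1 y + wt 1 (x - y) := by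
    intro x y
    have h0 : ∀ η, wt 1 η ^ 2 = 1 + (2 * Real.pi * η) ^ 2 := fun η => by
      rw [wt_sq, Real.rpow_one]
    refine abs_le_of_sq_le_sq' ?_ (add_pos (wt_pos _ _) (wt_pos _ _)).le |>.2
    have h1 := abs_le_wt_one y
    have h2 := abs_le_wt_one (x - y)
    have h3 := mul_le_mul h1 h2 (abs_nonneg _) (wt_pos _ _).le
    rw [← abs_mul] at h3
    have h4 := le_trans (le_abs_self _) h3
    have e : (2 * Real.pi * x) ^ 2 = (2 * Real.pi * y) ^ 2 + (2 * Real.pi * (x - y)) ^ 2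
      + 2 * ((2 * Real.pi * y) * (2 * Real.pi * (x - y))) := by ring
    rw [add_sq, h0, h0, h0, e]
    linarith
  have hsymm : wt 1 (y - x) = wt 1 (x - y) := by
    unfold wt; congr 2; ring
  have h1 := key x y
  have h2 := key y x
  rw [hsymm] at h2
  rw [abs_le]; constructor <;> linarith

/-- The difference of brackets gains a factor in x - y alone, and the larger bracket is at most
twice that of y or of x - y. -/
theorem abs_wt_sub_wt_le {s : ℝ} (hs : 1 ≤ s) (x y : ℝ) :
    |wt s x - wt s y| ≤ s * 2 ^ (s - 1) * (wt 1 (x - y) * wt (s - 1) y + wt s (x - y)) := by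
  have h1 := abs_rpow_sub_rpow_le (wt_pos 1 x) (wt_pos 1 y) hs
  rw [← wt_rpow, ← wt_rpow] at h1
  have h2 := abs_wt_one_sub_le x y
  have hxy : max (wt 1 x) (wt 1 y) ≤ 2 * max (wt 1 y) (wt 1 (x - y)) := by
    have h3 := (abs_le.1 h2).2
    have h4 := le_max_left (wt 1 y) (wt 1 (x - y))
    have h5 := le_max_right (wt 1 y) (wt 1 (x - y))
    have := wt_pos 1 y
    refine max_le ?_ ?_ <;> linarith
  have h6 : max (wt 1 x) (wt 1 y) ^ (s - 1)
      ≤ 2 ^ (s - 1) * (wt (s - 1) y + wt (s - 1) (x - y)) := by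
    calc _ ≤ (2 * max (wt 1 y) (wt 1 (x - y))) ^ (s - 1) := by
          refine Real.rpow_le_rpow (le_max_of_le_left (wt_pos _ _).le) hxy (by linarith)
      _ = 2 ^ (s - 1) * max (wt 1 y) (wt 1 (x - y)) ^ (s - 1) := by
          rw [Real.mul_rpow (by norm_num) (le_max_of_le_left (wt_pos _ _).le)]
      _ ≤ _ := by
          gcongr
          rw [wt_rpow (s - 1) y, wt_rpow (s - 1) (x - y)]
          have p1 := Real.rpow_pos_of_pos (wt_pos 1 y) (s - 1)
          have p2 := Real.rpow_pos_of_pos (wt_pos 1 (x - y)) (s - 1)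
          rcases max_choice (wt 1 y) (wt 1 (x - y)) with h | h <;> rw [h] <;> linarith
  have e : wt s (x - y) = wt 1 (x - y) * wt (s - 1) (x - y) := by
    rw [wt_mul_wt]; congr 1; ring
  calc _ ≤ s * (2 ^ (s - 1) * (wt (s - 1) y + wt (s - 1) (x - y))) * wt 1 (x - y) := by
        have := wt_pos (s - 1) y
        have := wt_pos (s - 1) (x - y)
        refine h1.trans ?_
        gcongr
    _ = _ := by rw [e]; ring

/-- The constant in the symbol estimate. -/
noncomputable def symConst (s : ℝ) : ℝ := s * 2 ^ (s - 1) + 1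

theorem symConst_pos {s : ℝ} (hs : 1 ≤ s) : 0 < symConst s := by
  unfold symConst; positivity

/-- A truncated version of the weight of order `s`. -/
structure IsTruncWt (s : ℝ) (p : ℝ → ℝ) : Prop where
  cont : Continuous p
  nonneg : ∀ x, 0 ≤ p x
  le_wt : ∀ x, p x ≤ wt s x
  sub_le : ∀ x y, |p x - p y| ≤ |wt s x - wt s y|
  bdd : ∃ N, ∀ x, p x ≤ N

/-- Taking the minimum with a constant is 1-Lipschitz, so differences of weights do not grow. This
makes later bounds independent of `N`. -/
theorem isTruncWt_min (s : ℝ) {N : ℝ} (hN : 0 ≤ N) : IsTruncWt s (fun x => min (wt s x) N) where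
  cont := (continuous_wt s).min continuous_const
  nonneg x := le_min (wt_pos _ _).le hN
  le_wt x := min_le_left _ _
  sub_le x y := by
    simpa using abs_min_sub_min_le_max (wt s x) N (wt s y) N
  bdd := ⟨N, fun x => min_le_right _ _⟩

/-- Writing x = y + (x - y) leaves (p x - p y) y - (x - y) p y up to 2π. Neither summand puts more
than order s on a single frequency, although the two separate products have order s + 1. -/
theorem IsTruncWt.symbol_le {s : ℝ} {p : ℝ → ℝ} (hp : IsTruncWt s p) (hs : 1 ≤ s) (x y : ℝ) :
    |p x * (2 * Real.pi * y) - 2 * Real.pi * x * p y|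
      ≤ symConst s * (wt 1 y * wt s (x - y) + wt s y * wt 1 (x - y)) := by
  have h1 := (hp.sub_le x y).trans (abs_wt_sub_wt_le hs x y)
  have h2 := abs_le_wt_one y
  have h3 := abs_le_wt_one (x - y)
  have e : p x * (2 * Real.pi * y) - 2 * Real.pi * x * p y
    = (p x - p y) * (2 * Real.pi * y) - (2 * Real.pi * (x - y)) * p y := by ring
  have e2 : wt s y = wt (s - 1) y * wt 1 y := by rw [wt_mul_wt]; congr 1; ring
  have hc : 0 ≤ s * 2 ^ (s - 1) := by positivity
  rw [e]
  calc _ ≤ |p x - p y| * |2 * Real.pi * y| + |2 * Real.pi * (x - y)| * p y := by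
        refine (abs_sub _ _).trans ?_
        rw [abs_mul (p x - p y), abs_mul _ (p y), abs_of_nonneg (hp.nonneg y)]
    _ ≤ s * 2 ^ (s - 1) * (wt 1 (x - y) * wt (s - 1) y + wt s (x - y)) * wt 1 y
        + wt 1 (x - y) * wt s y := by
        gcongr
        · exact mul_nonneg hc (add_pos (mul_pos (wt_pos _ _) (wt_pos _ _)) (wt_pos _ _)).le
        · exact hp.nonneg y
        · exact (wt_pos _ _).le
        · exact hp.le_wt y
    _ ≤ _ := by
        have := mul_pos (wt_pos 1 y) (wt_pos s (x - y))
        rw [symConst, e2]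
        nlinarith

/-! ### Bounded Fourier multipliers, the derivative and the operator `K`. -/

/-- The Fourier multiplier with the bounded real symbol `m` (in the variable `η = ξ / 2π`). -/
noncomputable def mop (m : ℝ → ℝ) : L2 →L[ℂ] L2 :=
  ((Lp.fourierTransformₗᵢ ℝ ℂ).symm.toContinuousLinearEquiv : L2 →L[ℂ] L2) ∘L
    mulCLM (fun η => (m η : ℂ)) ∘L
    ((Lp.fourierTransformₗᵢ ℝ ℂ).toContinuousLinearEquiv : L2 →L[ℂ] L2)

theorem mop_apply (m : ℝ → ℝ) (f : L2) :
    mop m f = 𝓕⁻ (mulCLM (fun η => (m η : ℂ)) (𝓕 f : L2)) := rfl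

theorem fourier_mop {m : ℝ → ℝ} {C : ℝ} (hm : BddBy (fun η => (m η : ℂ)) C) (f : L2) :
    (𝓕 (mop m f) : L2) =ᵐ[volume] fun η => (m η : ℂ) * (𝓕 f : L2) η := by
  rw [mop_apply, FourierTransform.fourier_fourierInv_eq]
  exact hm.mulCLM_coeFn _

theorem norm_mop_le {m : ℝ → ℝ} {C : ℝ} (hm : BddBy (fun η => (m η : ℂ)) C) (f : L2) :
    ‖mop m f‖ ≤ C * ‖f‖ := by
  rw [← Lp.norm_fourier_eq (mop m f), mop_apply, FourierTransform.fourier_fourierInv_eq,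
    hm.mulCLM_apply, ← Lp.norm_fourier_eq f]
  exact hm.norm_mulL2_le _

theorem IsTruncWt.bddBy {s : ℝ} {p : ℝ → ℝ} (hp : IsTruncWt s p) :
    ∃ N, BddBy (fun η => (p η : ℂ)) N := by
  obtain ⟨N, hN⟩ := hp.bdd
  refine ⟨N, (Complex.continuous_ofReal.comp hp.cont).aestronglyMeasurable,
    Eventually.of_forall fun x => ?_⟩
  rw [Complex.norm_real, Real.norm_of_nonneg (hp.nonneg x)]
  exact hN x

theorem IsTruncWt.fourier_mop {s : ℝ} {p : ℝ → ℝ} (hp : IsTruncWt s p) (f : L2) :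
    (𝓕 (mop p f) : L2) =ᵐ[volume] fun η => (p η : ℂ) * (𝓕 f : L2) η := by
  obtain ⟨N, hN⟩ := hp.bddBy
  exact NonlocalWave.fourier_mop hN f

/-- The bound does not see the truncation level, only `p ≤ wt s`. -/
theorem IsTruncWt.norm_mop_le {s : ℝ} {p : ℝ → ℝ} (hp : IsTruncWt s p) {f : L2} (hf : MemHs s f) :
    ‖mop p f‖ ≤ hsNorm s f := by
  refine le_trans ?_ hf.norm_wL2_le
  rw [← Lp.norm_fourier_eq (mop p f)]
  refine Lp.norm_le_norm_of_ae_le ?_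
  filter_upwards [hf.wL2_coeFn, hp.fourier_mop f] with x h1 h2
  rw [h1, h2, norm_wfun, norm_mul, Complex.norm_real, Real.norm_of_nonneg (hp.nonneg x)]
  gcongr
  exact hp.le_wt x

theorem memHs_of_fourier_le {s C r : ℝ} {f g : L2} (hg : MemHs r g)
    (h : ∀ᵐ η, wt s η * ‖(𝓕 f : L2) η‖ ≤ C * (wt r η * ‖(𝓕 g : L2) η‖)) : MemHs s f := by
  rw [memHs_iff] at *
  refine hg.of_le_mul (aestronglyMeasurable_wfun s f) (c := C) ?_
  filter_upwards [h] with x hx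
  rwa [norm_wfun, norm_wfun]

theorem memHs_mop {s C : ℝ} {m : ℝ → ℝ} (hm : BddBy (fun η => (m η : ℂ)) C) {f : L2}
    (hf : MemHs s f) : MemHs s (mop m f) := by
  refine memHs_of_fourier_le (C := C) hf ?_
  filter_upwards [fourier_mop hm f, hm.2] with x h1 h2
  rw [h1, norm_mul]
  have := mul_le_mul_of_nonneg_right h2 (mul_nonneg (wt_pos s x).le (norm_nonneg ((𝓕 f : L2) x)))
  linarith

/-- The condition `1 ≤ s` puts the product with iξ in `L²`, so that `mulL2` does not take its
default value. -/
theorem fourier_Dx {s : ℝ} {f : L2} (hf : MemHs s f) (hs : 1 ≤ s) :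
    (𝓕 (Dx f) : L2) =ᵐ[volume]
      fun η => Complex.I * ((2 * Real.pi * η : ℝ) : ℂ) * (𝓕 f : L2) η := by
  rw [Dx, fourierMult, FourierTransform.fourier_fourierInv_eq]
  refine mulL2_coeFn ?_
  have h := (memHs_iff s f).1 hf
  refine h.mono ?_ (Eventually.of_forall fun x => ?_)
  · exact (Continuous.aestronglyMeasurable (by fun_prop)).mul (Lp.aestronglyMeasurable _)
  · rw [norm_wfun, norm_mul, norm_mul, Complex.norm_I, one_mul, Complex.norm_real, Real.norm_eq_abs]
    gcongr
    exact (abs_le_wt_one x).trans (wt_mono hs x)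

theorem memHs_Dx {s : ℝ} {f : L2} (hf : MemHs s f) (hs : 1 ≤ s) : MemHs (s - 1) (Dx f) := by
  refine memHs_of_fourier_le (C := 1) hf ?_
  filter_upwards [fourier_Dx hf hs] with x h1
  rw [h1, norm_mul, norm_mul, Complex.norm_I, one_mul, Complex.norm_real, Real.norm_eq_abs, one_mul,
    ← mul_assoc, show wt s x = wt (s - 1) x * wt 1 x by rw [wt_mul_wt]; congr 1; ring]
  gcongr
  · exact (wt_pos _ _).le
  · exact abs_le_wt_one x

theorem K_eq_mop {b : ℝ → ℝ} {C : ℝ}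
    (hb : BddBy (fun η => (Real.sqrt (b (2 * Real.pi * η)) : ℂ)) C) (f : L2) :
    K b f = mop (fun η => Real.sqrt (b (2 * Real.pi * η))) f := by
  rw [K, fourierMult, mop_apply, hb.mulCLM_apply]

theorem bddBy_sqrt {b : ℝ → ℝ} {B : ℝ} (hm : Measurable b) (hB : ∀ ξ, 0 ≤ b ξ ∧ b ξ ≤ B) :
    BddBy (fun η => (Real.sqrt (b (2 * Real.pi * η)) : ℂ)) (Real.sqrt B) := by
  refine ⟨Measurable.aestronglyMeasurable (by fun_prop), Eventually.of_forall fun x => ?_⟩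
  rw [Complex.norm_real, Real.norm_of_nonneg (Real.sqrt_nonneg _)]
  exact Real.sqrt_le_sqrt (hB _).2

theorem MemHs.eLpNorm_wfun_le {s : ℝ} {f : L2} (h : MemHs s f) :
    eLpNorm (wfun s f) 2 volume ≤ ENNReal.ofReal (hsNorm s f) := by
  refine le_trans (le_of_eq ?_) (ENNReal.ofReal_le_ofReal h.norm_wL2_le)
  rw [Lp.norm_def, ENNReal.ofReal_toReal (Lp.memLp _).2.ne]
  exact (eLpNorm_congr_ae h.wL2_coeFn).symm

/-! ### The commutator estimate. -/

/-- The transform of `P(w u_x) - (w P u)_x`. -/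
noncomputable def brk (p : ℝ → ℝ) (w u : L2) (ξ : ℝ) : ℂ :=
  (p ξ : ℂ) * (𝓕 (mulL2 w (Dx u)) : L2) ξ
    - Complex.I * ((2 * Real.pi * ξ : ℝ) : ℂ) * (𝓕 (mulL2 w (mop p u)) : L2) ξ

theorem aestronglyMeasurable_brk {p : ℝ → ℝ} (hp : Continuous p) (w u : L2) :
    AEStronglyMeasurable (brk p w u) volume :=
  ((Complex.continuous_ofReal.comp hp).aestronglyMeasurable.mul (Lp.aestronglyMeasurable _)).sub
    ((Continuous.aestronglyMeasurable (by fun_prop)).mul (Lp.aestronglyMeasurable _))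

/-- Both products become convolutions of the same pair of transforms, so they merge into one
integral to which the symbol estimate applies. -/
theorem enorm_brk_le {s : ℝ} (hs : 3 / 2 < s) {p : ℝ → ℝ} (hp : IsTruncWt s p) {w u : L2}
    (hw : MemHs s w) (hu : MemHs s u) :
    ∀ᵐ ξ, ‖brk p w u ξ‖ₑ ≤ ENNReal.ofReal (symConst s) *
      ((∫⁻ t, ‖wfun 1 u t‖ₑ * ‖wfun s w (-t + ξ)‖ₑ)
        + ∫⁻ t, ‖wfun 1 w t‖ₑ * ‖wfun s u (-t + ξ)‖ₑ) := by
  obtain ⟨N, hN⟩ := hp.bddBy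
  have hwi := hw.integrable_fourier (by linarith)
  have hDi := (memHs_Dx hu (by linarith)).integrable_fourier (by linarith)
  have hPi := (memHs_mop hN hu).integrable_fourier (by linarith)
  have hwb := hw.bddBy (by linarith)
  have hmeas : ∀ (r r' : ℝ) (f g : L2) (ξ : ℝ),
      AEMeasurable (fun t => ‖wfun r f t‖ₑ * ‖wfun r' g (-t + ξ)‖ₑ) := by
    intro r r' f g ξ
    have hq : Measure.QuasiMeasurePreserving (fun y : ℝ => -y + ξ) volume volume :=
      ((measurePreserving_add_right (volume : Measure ℝ) ξ).comp
          (Measure.measurePreserving_neg (volume : Measure ℝ))).quasiMeasurePreserving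
    exact (aestronglyMeasurable_wfun r f).enorm.mul
      ((aestronglyMeasurable_wfun r' g).enorm.comp_quasiMeasurePreserving hq)
  filter_upwards [fourier_mulL2_ae_eq hwi hDi hwb, fourier_mulL2_ae_eq hwi hPi hwb,
    hDi.ae_convolution_exists (ContinuousLinearMap.mul ℂ ℂ) hwi,
    hPi.ae_convolution_exists (ContinuousLinearMap.mul ℂ ℂ) hwi] with ξ h1 h2 h3 h4
  simp only [ConvolutionExistsAt, ContinuousLinearMap.mul_apply', sub_eq_neg_add] at h3 h4
  -- The second convolution is flipped so that the transform of `u` sits at t in both.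
  have hcomm : ∫⁻ t, ‖wfun 1 w t‖ₑ * ‖wfun s u (-t + ξ)‖ₑ
      = ∫⁻ t, ‖wfun s u t‖ₑ * ‖wfun 1 w (-t + ξ)‖ₑ :=
    congrFun (lconvolution_comm (μ := (volume : Measure ℝ)) (f := fun t => ‖wfun 1 w t‖ₑ)
      (g := fun t => ‖wfun s u t‖ₑ)) ξ
  rw [hcomm, ← lintegral_add_left' (hmeas _ _ _ _ _), ← lintegral_const_mul' _ _ ENNReal.ofReal_ne_top,
    brk, h1, h2, ← integral_const_mul, ← integral_const_mul,
    ← integral_sub (h3.const_mul _) (h4.const_mul _)]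
  refine (enorm_integral_le_lintegral_enorm _).trans (lintegral_mono_ae ?_)
  filter_upwards [fourier_Dx hu (by linarith), hp.fourier_mop u] with t h5 h6
  rw [h5, h6]
  have hsym := hp.symbol_le (by linarith : 1 ≤ s) ξ t
  set U := (𝓕 u : L2) t
  set W := (𝓕 w : L2) (-t + ξ)
  have e : (p ξ : ℂ) * (Complex.I * ((2 * Real.pi * t : ℝ) : ℂ) * U * W)
      - Complex.I * ((2 * Real.pi * ξ : ℝ) : ℂ) * ((p t : ℂ) * U * W)
      = Complex.I * ((p ξ * (2 * Real.pi * t) - 2 * Real.pi * ξ * p t : ℝ) : ℂ) * (U * W) := by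
    push_cast; ring
  have hS := symConst_pos (by linarith : 1 ≤ s)
  rw [e, ← ofReal_norm, ← ofReal_norm, ← ofReal_norm, ← ofReal_norm, ← ofReal_norm,
    ← ENNReal.ofReal_mul (norm_nonneg _), ← ENNReal.ofReal_mul (norm_nonneg _),
    ← ENNReal.ofReal_add (by positivity) (by positivity), ← ENNReal.ofReal_mul hS.le]
  refine ENNReal.ofReal_le_ofReal ?_
  rw [norm_mul, norm_mul, Complex.norm_I, one_mul, Complex.norm_real, Real.norm_eq_abs, norm_mul,
    norm_wfun, norm_wfun, norm_wfun, norm_wfun]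
  have e3 : -t + ξ = ξ - t := by ring
  calc _ ≤ symConst s * (wt 1 t * wt s (ξ - t) + wt s t * wt 1 (ξ - t)) * (‖U‖ * ‖W‖) := by gcongr
    _ = _ := by simp only [U, W, e3]; ring

/-- Young's inequality: in each convolution the factor of order 1 is integrable since `s - 1 > 1/2`,
and the factor of order s is in `L²`. -/
theorem eLpNorm_brk_le {s : ℝ} (hs : 3 / 2 < s) {p : ℝ → ℝ} (hp : IsTruncWt s p) {w u : L2}
    (hw : MemHs s w) (hu : MemHs s u) :
    eLpNorm (brk p w u) 2 volume
      ≤ ENNReal.ofReal (2 * symConst s * sobConst (s - 1) * (hsNorm s w * hsNorm s u)) := by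
  have hS := symConst_pos (by linarith : 1 ≤ s)
  have hY : ∀ f g : L2, MemHs s f → MemHs s g →
      AEMeasurable (fun ξ => ∫⁻ t, ‖wfun 1 f t‖ₑ * ‖wfun s g (-t + ξ)‖ₑ) ∧
      eLpNorm (fun ξ => ∫⁻ t, ‖wfun 1 f t‖ₑ * ‖wfun s g (-t + ξ)‖ₑ) 2 volume ≤
        ENNReal.ofReal (sobConst (s - 1) * hsNorm s f * hsNorm s g) := by
    intro f g hf hg
    constructor
    · exact aemeasurable_lconvolution (aestronglyMeasurable_wfun 1 f).enorm
        (aestronglyMeasurable_wfun s g).enorm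
    refine (eLpNorm_lconvolution_le (aestronglyMeasurable_wfun 1 f).enorm
      (aestronglyMeasurable_wfun s g).enorm).trans ?_
    rw [eLpNorm_enorm, ENNReal.ofReal_mul (mul_nonneg (sobConst_nonneg _) (hsNorm_nonneg _ _))]
    exact mul_le_mul' (hf.lintegral_wfun_le (by linarith)) hg.eLpNorm_wfun_le
  have h1 := hY u w hu hw
  have h2 := hY w u hw hu
  calc eLpNorm (brk p w u) 2 volume
      ≤ eLpNorm (fun ξ => ENNReal.ofReal (symConst s) *
        ((∫⁻ t, ‖wfun 1 u t‖ₑ * ‖wfun s w (-t + ξ)‖ₑ)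
        + ∫⁻ t, ‖wfun 1 w t‖ₑ * ‖wfun s u (-t + ξ)‖ₑ)) 2 volume := by
        refine eLpNorm_mono_enorm_ae ?_
        simpa only [enorm_eq_self] using enorm_brk_le hs hp hw hu
    _ ≤ ENNReal.ofReal (symConst s) * eLpNorm (fun ξ =>
        ((∫⁻ t, ‖wfun 1 u t‖ₑ * ‖wfun s w (-t + ξ)‖ₑ)
        + ∫⁻ t, ‖wfun 1 w t‖ₑ * ‖wfun s u (-t + ξ)‖ₑ)) 2 volume := by
        rw [eLpNorm_eq_lintegral_rpow_enorm_toReal (by norm_num) (by norm_num),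
          eLpNorm_eq_lintegral_rpow_enorm_toReal (by norm_num) (by norm_num)]
        simp only [enorm_eq_self, ENNReal.toReal_ofNat]
        simp only [ENNReal.mul_rpow_of_nonneg _ _ (zero_le_two : (0 : ℝ) ≤ 2)]
        rw [lintegral_const_mul' _ _ (ENNReal.rpow_ne_top_of_nonneg zero_le_two ENNReal.ofReal_ne_top),
          ENNReal.mul_rpow_of_nonneg _ _ (by norm_num), ← ENNReal.rpow_mul]
        norm_num
    _ ≤ ENNReal.ofReal (symConst s) * (ENNReal.ofReal (sobConst (s - 1) * hsNorm s u * hsNorm s w)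
        + ENNReal.ofReal (sobConst (s - 1) * hsNorm s w * hsNorm s u)) := by
        gcongr
        refine (eLpNorm_add_le h1.1.aestronglyMeasurable h2.1.aestronglyMeasurable
          (by norm_num)).trans (add_le_add h1.2 h2.2)
    _ = _ := by
        have := sobConst_nonneg (s - 1)
        have := hsNorm_nonneg s u
        have := hsNorm_nonneg s w
        rw [← ENNReal.ofReal_add (by positivity) (by positivity), ← ENNReal.ofReal_mul hS.le]
        congr 1; ring

/-! ### Cancellation of the leading terms. -/

/-- The leading terms of the energy identity cancel up to a commutator. -/
theorem norm_inner_add_inner_le {s κ : ℝ} (hs : 3 / 2 < s) (hκ : 0 ≤ κ) {p k : ℝ → ℝ}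
    (hp : IsTruncWt s p) (hk : BddBy (fun η => (k η : ℂ)) κ) {w u v : L2}
    (hw : MemHs s w) (hu : MemHs s u) (hv : MemHs s v) :
    ‖inner ℂ (mulL2 w (mop p u)) (mop p (mop k (Dx v)))
      + inner ℂ (mop p (mop k (mulL2 w (Dx u)))) (mop p v)‖
      ≤ 2 * symConst s * sobConst (s - 1) * κ * (hsNorm s w * hsNorm s u * hsNorm s v) := by
  have hΦ := eLpNorm_brk_le hs hp hw hu
  have hΦm : MemLp (brk p w u) 2 volume :=
    ⟨aestronglyMeasurable_brk hp.cont w u, hΦ.trans_lt ENNReal.ofReal_lt_top⟩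
  have hS := symConst_pos (by linarith : 1 ≤ s)
  have := sobConst_nonneg (s - 1)
  have := hsNorm_nonneg s u
  have := hsNorm_nonneg s w
  -- The factor iξ of `Dx v` is moved to the other side pointwise under the Plancherel integral.
  -- Hence (w P u)_x need not lie in `L²` by itself; only `brk` must.
  have key : inner ℂ (mulL2 w (mop p u)) (mop p (mop k (Dx v)))
      + inner ℂ (mop p (mop k (mulL2 w (Dx u)))) (mop p v)
      = inner ℂ (hΦm.toLp _) (𝓕 (mop k (mop p v)) : L2) := by
    rw [← Lp.inner_fourier_eq, ← Lp.inner_fourier_eq (mop p (mop k (mulL2 w (Dx u)))),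
      L2.inner_def, L2.inner_def, L2.inner_def, ← integral_add (L2.integrable_inner _ _)
        (L2.integrable_inner _ _)]
    refine integral_congr_ae ?_
    filter_upwards [hΦm.coeFn_toLp, fourier_mop hk (mop p v), hp.fourier_mop v,
      hp.fourier_mop (mop k (Dx v)), fourier_mop hk (Dx v), fourier_Dx hv (by linarith),
      hp.fourier_mop (mop k (mulL2 w (Dx u))), fourier_mop hk (mulL2 w (Dx u))]
      with ξ h1 h2 h3 h4 h5 h6 h7 h8
    rw [h1, h2, h3, h4, h5, h6, h7, h8, brk]
    simp only [RCLike.inner_apply, map_mul, map_sub, Complex.conj_I, Complex.conj_ofReal]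
    ring
  rw [key]
  refine (norm_inner_le_norm _ _).trans ?_
  rw [Lp.norm_fourier_eq]
  have h1 : ‖hΦm.toLp _‖ ≤ 2 * symConst s * sobConst (s - 1) * (hsNorm s w * hsNorm s u) := by
    rw [Lp.norm_toLp]
    exact ENNReal.toReal_le_of_le_ofReal (by positivity) hΦ
  have h2 : ‖mop k (mop p v)‖ ≤ κ * hsNorm s v :=
    (norm_mop_le hk _).trans (by gcongr; exact hp.norm_mop_le hv)
  calc _ ≤ (2 * symConst s * sobConst (s - 1) * (hsNorm s w * hsNorm s u)) * (κ * hsNorm s v) := by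
        gcongr
    _ = _ := by ring

/-- The symbols of P and K are real and that of `Dx` is imaginary, so the two integrands are
opposite at each frequency. -/
theorem inner_add_inner_eq_zero {s κ : ℝ} (hs : 1 ≤ s) {p k : ℝ → ℝ}
    (hp : IsTruncWt s p) (hk : BddBy (fun η => (k η : ℂ)) κ) {u v : L2}
    (hu : MemHs s u) (hv : MemHs s v) :
    inner ℂ (mop p u) (mop p (mop k (Dx v))) + inner ℂ (mop p (mop k (Dx u))) (mop p v) = 0 := by
  rw [← Lp.inner_fourier_eq, ← Lp.inner_fourier_eq (mop p (mop k (Dx u))),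
    L2.inner_def, L2.inner_def, ← integral_add (L2.integrable_inner _ _) (L2.integrable_inner _ _)]
  refine integral_eq_zero_of_ae ?_
  filter_upwards [hp.fourier_mop u, hp.fourier_mop v,
    hp.fourier_mop (mop k (Dx v)), fourier_mop hk (Dx v), fourier_Dx hv hs,
    hp.fourier_mop (mop k (Dx u)), fourier_mop hk (Dx u), fourier_Dx hu hs]
    with ξ h1 h2 h3 h4 h5 h6 h7 h8
  rw [h1, h2, h3, h4, h5, h6, h7, h8]
  simp only [RCLike.inner_apply, map_mul, Complex.conj_I, Complex.conj_ofReal, Pi.zero_apply]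
  ring

/-! ### Time derivatives in `L²` and of multiplication operators. -/

theorem HasTimeDeriv.hasDerivWithinAt {σ T : ℝ} {f f' : ℝ → L2} (h : HasTimeDeriv σ T f f')
    (hσ : 0 ≤ σ) {t : ℝ} (ht : t ∈ Icc 0 T) : HasDerivWithinAt f (f' t) (Icc 0 T) t := by
  rw [hasDerivWithinAt_iff_tendsto_slope, tendsto_iff_norm_sub_tendsto_zero]
  refine squeeze_zero' (Eventually.of_forall fun _ => norm_nonneg _) ?_ (h.2 t ht)
  filter_upwards [self_mem_nhdsWithin] with τ hτ
  rw [slope_def_module]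
  exact ((((h.1 τ hτ.1).1.sub (h.1 t ht).1).smul _).sub (h.1 t ht).2).norm_le hσ

/-- Linearity of `mulCLM` in its symbol has to be checked for bounded symbols, since unbounded ones
give the default value 0. -/
theorem mulCLM_slope {w₁ w₂ w' : L2} {C₁ C₂ C' : ℝ} (h₁ : BddBy w₁ C₁) (h₂ : BddBy w₂ C₂)
    (h' : BddBy w' C') {r C : ℝ} (h : BddBy (r • (w₁ - w₂) - w' : L2) C) :
    mulCLM (r • (w₁ - w₂) - w' : L2) = r • (mulCLM w₁ - mulCLM w₂) - mulCLM w' := by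
  ext1 f
  apply Lp.ext
  have e : (r • (mulCLM w₁ - mulCLM w₂) - mulCLM w') f
    = r • (mulCLM w₁ f - mulCLM w₂ f) - mulCLM w' f := rfl
  rw [e]
  filter_upwards [h.mulCLM_coeFn f, h₁.mulCLM_coeFn f, h₂.mulCLM_coeFn f, h'.mulCLM_coeFn f,
    Lp.coeFn_sub (r • (w₁ - w₂)) w', Lp.coeFn_smul r (w₁ - w₂), Lp.coeFn_sub w₁ w₂,
    Lp.coeFn_sub (r • (mulCLM w₁ f - mulCLM w₂ f)) (mulCLM w' f),
    Lp.coeFn_smul r (mulCLM w₁ f - mulCLM w₂ f), Lp.coeFn_sub (mulCLM w₁ f) (mulCLM w₂ f)]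
    with x a1 a2 a3 a4 a5 a6 a7 a8 a9 a10
  rw [a1, a5, Pi.sub_apply, a6, Pi.smul_apply, a7, Pi.sub_apply, a8, Pi.sub_apply, a9,
    Pi.smul_apply, a10, Pi.sub_apply, a2, a3, a4, Complex.real_smul, Complex.real_smul]
  ring

/-- Since `H^σ` embeds in `L^∞`, convergence of difference quotients in `H^σ` gives convergence of
the multiplication operators in operator norm. -/
theorem HasTimeDeriv.hasDerivWithinAt_mulCLM {σ T : ℝ} {w w' : ℝ → L2}
    (h : HasTimeDeriv σ T w w') (hσ : 1 / 2 < σ) {t : ℝ} (ht : t ∈ Icc 0 T) :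
    HasDerivWithinAt (fun τ => mulCLM (w τ)) (mulCLM (w' t)) (Icc 0 T) t := by
  rw [hasDerivWithinAt_iff_tendsto_slope, tendsto_iff_norm_sub_tendsto_zero]
  have h0 := (h.2 t ht).const_mul (sobConst σ)
  rw [mul_zero] at h0
  refine squeeze_zero' (Eventually.of_forall fun _ => norm_nonneg _) ?_ h0
  filter_upwards [self_mem_nhdsWithin] with τ hτ
  have hq := ((((h.1 τ hτ.1).1.sub (h.1 t ht).1).smul (τ - t)⁻¹).sub (h.1 t ht).2)
  rw [slope_def_module, ← mulCLM_slope ((h.1 τ hτ.1).1.bddBy hσ) ((h.1 t ht).1.bddBy hσ)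
    ((h.1 t ht).2.bddBy hσ) (hq.bddBy hσ)]
  exact (hq.bddBy hσ).norm_mulCLM_le (mul_nonneg (sobConst_nonneg _) (hsNorm_nonneg _ _))

/-! ### The energy, its derivative and its coercivity. -/

/-- The energy with the multiplier `p`: `∫ (1 + w) |Pu|² + ∫ |Pv|²`. -/
noncomputable def energy (p : ℝ → ℝ) (w u v : L2) : ℝ :=
  (inner ℂ (mop p u) (mop p u) + inner ℂ (mulCLM w (mop p u)) (mop p u)
    + inner ℂ (mop p v) (mop p v) : ℂ).re

/-- The derivative of `energy` in the direction `(w', u', v')`. -/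
noncomputable def energyDeriv (p : ℝ → ℝ) (w u v w' u' v' : L2) : ℝ :=
  ((inner ℂ (mop p u) (mop p u') + inner ℂ (mop p u') (mop p u))
    + (inner ℂ (mulCLM w (mop p u)) (mop p u')
      + inner ℂ (mulCLM w' (mop p u) + mulCLM w (mop p u')) (mop p u))
    + (inner ℂ (mop p v) (mop p v') + inner ℂ (mop p v') (mop p v)) : ℂ).re

theorem hasDerivWithinAt_energy (p : ℝ → ℝ) {w u v : ℝ → L2} {w' u' v' : L2} {S : Set ℝ} {t : ℝ}
    (hw : HasDerivWithinAt (fun τ => mulCLM (w τ)) (mulCLM w') S t)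
    (hu : HasDerivWithinAt u u' S t) (hv : HasDerivWithinAt v v' S t) :
    HasDerivWithinAt (fun τ => energy p (w τ) (u τ) (v τ))
      (energyDeriv p (w t) (u t) (v t) w' u' v') S t := by
  have hP : ∀ {f : ℝ → L2} {f' : L2}, HasDerivWithinAt f f' S t →
      HasDerivWithinAt (fun τ => mop p (f τ)) (mop p f') S t := fun h =>
    ((mop p).restrictScalars ℝ).hasFDerivAt.comp_hasDerivWithinAt t h
  have hW : HasDerivWithinAt (fun τ => mulCLM (w τ) (mop p (u τ)))
      (mulCLM w' (mop p (u t)) + mulCLM (w t) (mop p u')) S t := by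
    have h1 : HasDerivWithinAt (fun τ => (mulCLM (w τ)).restrictScalars ℝ)
        ((mulCLM w').restrictScalars ℝ) S t :=
      (ContinuousLinearMap.restrictScalarsL ℂ L2 L2 ℝ ℝ).hasFDerivAt.comp_hasDerivWithinAt t hw
    exact h1.clm_apply (hP hu)
  have := ((((hP hu).inner ℂ (hP hu)).add (hW.inner ℂ (hP hu))).add ((hP hv).inner ℂ (hP hv)))
  exact Complex.reCLM.hasFDerivAt.comp_hasDerivWithinAt t this

/-- Self-adjointness, the place where `w` must be real: it lets the terms of the energy derivative
pair up. -/
theorem inner_mulCLM_comm {w : L2} {C : ℝ} (hw : BddBy w C) (hr : ∀ᵐ x, (w x).im = 0) (f g : L2) :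
    inner ℂ (mulCLM w f) g = inner ℂ f (mulCLM w g) := by
  rw [inner_eq_integral, inner_eq_integral]
  refine integral_congr_ae ?_
  filter_upwards [hw.mulCLM_coeFn f, hw.mulCLM_coeFn g, hr] with x h1 h2 h3
  rw [h1, h2, map_mul, Complex.conj_eq_iff_im.2 h3]
  ring

theorem le_re_inner_mulCLM {w : L2} {C c : ℝ} (hw : BddBy w C)
    (hr : ∀ᵐ x, (w x).im = 0 ∧ c ≤ 1 + (w x).re) (f : L2) :
    c * ‖f‖ ^ 2 ≤ (inner ℂ f f + inner ℂ (mulCLM w f) f : ℂ).re := by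
  rw [← inner_add_left, norm_sq_eq_integral, ← integral_const_mul, L2.inner_def]
  have hi := L2.integrable_inner (𝕜 := ℂ) (f + mulCLM w f) f
  have e : (∫ x, inner ℂ ((f + mulCLM w f : L2) x) (f x) : ℂ).re
      = ∫ x, (inner ℂ ((f + mulCLM w f : L2) x) (f x) : ℂ).re := (integral_re hi).symm
  rw [e]
  refine integral_mono_ae ?_ hi.re ?_
  · exact ((Lp.memLp f).integrable_norm_pow two_ne_zero).const_mul c
  filter_upwards [hw.mulCLM_coeFn f, hr, Lp.coeFn_add f (mulCLM w f)] with x h1 h2 h3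
  have e2 : (inner ℂ ((f + mulCLM w f : L2) x) (f x) : ℂ).re = (1 + (w x).re) * ‖f x‖ ^ 2 := by
    rw [h3, Pi.add_apply, h1, Complex.sq_norm, Complex.normSq_apply]
    simp only [RCLike.inner_apply, map_add, map_mul, Complex.mul_re, Complex.add_re, Complex.conj_re,
      Complex.conj_im, Complex.mul_im, Complex.add_im, h2.1]
    ring
  simp only [e2]
  gcongr
  exact h2.2

theorem re_inner_self (f : L2) : (inner ℂ f f : ℂ).re = ‖f‖ ^ 2 := by
  rw [inner_self_eq_norm_sq_to_K]
  norm_cast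

theorem le_energy {p : ℝ → ℝ} {w u v : L2} {C c : ℝ} (hw : BddBy w C)
    (hr : ∀ᵐ x, (w x).im = 0 ∧ c ≤ 1 + (w x).re) :
    min c 1 * (‖mop p u‖ ^ 2 + ‖mop p v‖ ^ 2) ≤ energy p w u v := by
  have h1 := le_re_inner_mulCLM hw hr (mop p u)
  have h2 := re_inner_self (mop p v)
  rw [energy, Complex.add_re, h2]
  have h3 := mul_le_mul_of_nonneg_right (min_le_left c 1) (sq_nonneg ‖mop p u‖)
  have h4 := mul_le_mul_of_nonneg_right (min_le_right c 1) (sq_nonneg ‖mop p v‖)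
  linarith

theorem energy_le {s : ℝ} {p : ℝ → ℝ} (hp : IsTruncWt s p) {w u v : L2} {C : ℝ} (hC : 0 ≤ C)
    (hw : BddBy w C) (hu : MemHs s u) (hv : MemHs s v) :
    energy p w u v ≤ (1 + C) * (hsNorm s u + hsNorm s v) ^ 2 := by
  have h1 := re_inner_self (mop p u)
  have h2 := re_inner_self (mop p v)
  have h3 : (inner ℂ (mulCLM w (mop p u)) (mop p u) : ℂ).re ≤ C * ‖mop p u‖ ^ 2 := by
    refine (Complex.re_le_norm _).trans ((norm_inner_le_norm _ _).trans ?_)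
    have := (mulCLM w).le_of_opNorm_le (hw.norm_mulCLM_le hC) (mop p u)
    nlinarith [norm_nonneg (mop p u)]
  have h4 := hp.norm_mop_le hu
  have h5 := hp.norm_mop_le hv
  rw [energy, Complex.add_re, Complex.add_re, h1, h2]
  have h6 : ‖mop p u‖ ^ 2 ≤ hsNorm s u ^ 2 := by gcongr
  have h7 : ‖mop p v‖ ^ 2 ≤ hsNorm s v ^ 2 := by gcongr
  nlinarith [hsNorm_nonneg s u, hsNorm_nonneg s v, mul_nonneg (hsNorm_nonneg s u) (hsNorm_nonneg s v),
    mul_nonneg hC (mul_nonneg (hsNorm_nonneg s u) (hsNorm_nonneg s v)), mul_le_mul_of_nonneg_left h6 hC,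
    mul_nonneg hC (sq_nonneg (hsNorm s v))]

theorem mulL2_one_add {w : L2} {C : ℝ} (hw : BddBy w C) (f : L2) :
    mulL2 (fun x => 1 + w x) f = f + mulL2 w f := by
  have hb : BddBy (fun x => 1 + w x) (1 + C) := by
    refine ⟨aestronglyMeasurable_const.add hw.1, hw.2.mono fun x hx => ?_⟩
    refine (norm_add_le _ _).trans ?_
    rw [norm_one]; linarith
  apply Lp.ext
  filter_upwards [mulL2_coeFn (hb.memLp_mul f), mulL2_coeFn (hw.memLp_mul f),
    Lp.coeFn_add f (mulL2 w f)] with x h1 h2 h3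
  rw [h1, h3, Pi.add_apply, h2]; ring

/-! ### The differential inequality for the energy. -/

/-- The constant in the differential inequality for the energy. -/
noncomputable def enConst (s B A R : ℝ) : ℝ :=
  4 * symConst s * sobConst (s - 1) * Real.sqrt B * R + sobConst (s - 1) * R + 2 * |A|
    + 4 + 2 * (sobConst s * R)

/-- The 0 is the cancelling group, x₁ the commutator, x₂, x₃ and x₅ the sources, x₄ the term with
`w_t`, and x₆ the term with `G`. The summand 4 collects 2x₂ and 2x₅. -/
theorem energyDeriv_arith {S M M' κ R A W a b f₁ f₂ x₁ x₂ x₃ x₄ x₅ x₆ : ℝ} (hS : 0 ≤ S) (hM : 0 ≤ M)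
    (hM' : 0 ≤ M') (hκ : 0 ≤ κ) (hR : 0 ≤ R) (a0 : 0 ≤ a) (b0 : 0 ≤ b) (f10 : 0 ≤ f₁)
    (f20 : 0 ≤ f₂) (hW : W ≤ R) (h₁ : x₁ ≤ 2 * S * M' * κ * (W * a * b)) (h₂ : x₂ ≤ a * f₁)
    (h₃ : x₃ ≤ M * R * a * f₁) (h₄ : x₄ ≤ M' * R * a * a) (h₅ : x₅ ≤ b * f₂)
    (h₆ : x₆ ≤ b * (|A| * a)) :
    2 * 0 + 2 * x₁ + 2 * x₂ + 2 * x₃ + x₄ + 2 * x₅ + 2 * x₆ ≤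
      (4 * S * M' * κ * R + M' * R + 2 * |A| + 4 + 2 * (M * R)) *
        ((a + b) ^ 2 + (a + b) * (f₁ + f₂)) := by
  have hww : 2 * S * M' * κ * (W * a * b) ≤ 2 * S * M' * κ * R * (a * b) := by
    have : W * a * b ≤ R * (a * b) := by rw [mul_assoc]; gcongr
    calc _ ≤ 2 * S * M' * κ * (R * (a * b)) := by gcongr
      _ = _ := by ring
  have m1 := mul_nonneg a0 b0
  have m2 := mul_nonneg a0 f10
  have m3 := mul_nonneg a0 f20
  have m4 := mul_nonneg b0 f10
  have m5 := mul_nonneg b0 f20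
  have m6 := mul_nonneg a0 a0
  have m7 := mul_nonneg b0 b0
  have hY : (a + b) ^ 2 + (a + b) * (f₁ + f₂)
      = a * a + 2 * (a * b) + b * b + a * f₁ + a * f₂ + b * f₁ + b * f₂ := by ring
  have q1 : a * b ≤ (a + b) ^ 2 + (a + b) * (f₁ + f₂) := by linarith
  have q2 : a * a ≤ (a + b) ^ 2 + (a + b) * (f₁ + f₂) := by linarith
  have q3 : a * f₁ ≤ (a + b) ^ 2 + (a + b) * (f₁ + f₂) := by linarith
  have q4 : b * f₂ ≤ (a + b) ^ 2 + (a + b) * (f₁ + f₂) := by linarith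
  generalize (a + b) ^ 2 + (a + b) * (f₁ + f₂) = Y at *
  have r1 := mul_le_mul_of_nonneg_left q1 (show 0 ≤ 4 * S * M' * κ * R by positivity)
  have r2 := mul_le_mul_of_nonneg_left q2 (show 0 ≤ M' * R by positivity)
  have r3 := mul_le_mul_of_nonneg_left q3 (show 0 ≤ 2 * (M * R) by positivity)
  have r4 := mul_le_mul_of_nonneg_left q1 (show 0 ≤ 2 * |A| by positivity)
  linarith

theorem energyDeriv_le {s κ A R : ℝ} (hs : 3 / 2 < s) (hR : 0 ≤ R) {p k : ℝ → ℝ} {B : ℝ}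
    (hκ : κ = Real.sqrt B)
    (hp : IsTruncWt s p) (hk : BddBy (fun η => (k η : ℂ)) κ) {w w' u v F₁ F₂ G : L2}
    (hw : MemHs s w) (hw' : MemHs (s - 1) w') (hu : MemHs s u) (hv : MemHs s v)
    (hF₁ : MemHs s F₁) (hF₂ : MemHs s F₂) (hG : MemHs s G) (hr : ∀ᵐ x, (w x).im = 0)
    (hwR : hsNorm s w ≤ R) (hwR' : hsNorm (s - 1) w' ≤ R) (hGA : hsNorm s G ≤ A * hsNorm s u) :
    energyDeriv p w u v w' (mop k (Dx v) + F₁)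
      (mop k (mulL2 (fun x => 1 + w x) (Dx u)) + F₂ + G) ≤
      enConst s B A R * ((hsNorm s u + hsNorm s v) ^ 2
        + (hsNorm s u + hsNorm s v) * (hsNorm s F₁ + hsNorm s F₂)) := by
  have hwb := hw.bddBy (by linarith)
  have hwb' := hw'.bddBy (by linarith)
  have hM := sobConst_nonneg s
  have hM' := sobConst_nonneg (s - 1)
  have hS := symConst_pos (by linarith : 1 ≤ s)
  have hκ0 : 0 ≤ κ := hκ ▸ Real.sqrt_nonneg _
  have a0 := hsNorm_nonneg s u
  have b0 := hsNorm_nonneg s v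
  have f10 := hsNorm_nonneg s F₁
  have f20 := hsNorm_nonneg s F₂
  have hmain := norm_inner_add_inner_le hs hκ0 hp hk hw hu hv
  have hzero := inner_add_inner_eq_zero (by linarith : 1 ≤ s) hp hk hu hv
  rw [← hwb.mulCLM_apply] at hmain
  have hPu := hp.norm_mop_le hu
  have hPv := hp.norm_mop_le hv
  have hP1 := hp.norm_mop_le hF₁
  have hP2 := hp.norm_mop_le hF₂
  have hPG := (hp.norm_mop_le hG).trans (hGA.trans
    (mul_le_mul_of_nonneg_right (le_abs_self A) a0))
  have hWu : ‖mulCLM w (mop p u)‖ ≤ sobConst s * R * hsNorm s u := by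
    refine ((mulCLM w).le_of_opNorm_le (hwb.norm_mulCLM_le (mul_nonneg hM (hsNorm_nonneg _ _))) _).trans ?_
    gcongr
  have hWu' : ‖mulCLM w' (mop p u)‖ ≤ sobConst (s - 1) * R * hsNorm s u := by
    refine ((mulCLM w').le_of_opNorm_le
      (hwb'.norm_mulCLM_le (mul_nonneg hM' (hsNorm_nonneg _ _))) _).trans ?_
    gcongr
  have cs : ∀ {f g : L2} {a b : ℝ}, ‖f‖ ≤ a → ‖g‖ ≤ b → 0 ≤ a → (inner ℂ f g : ℂ).re ≤ a * b := by
    intro f g a b h1 h2 h3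
    exact (Complex.re_le_norm _).trans ((norm_inner_le_norm _ _).trans
      (mul_le_mul h1 h2 (norm_nonneg _) h3))
  have i1 := cs hPu hP1 a0
  have i2 := cs hWu hP1 (by positivity)
  have i3 := cs hWu' hPu (by positivity)
  have i4 := cs hPv hP2 b0
  have i5 := cs hPv hPG b0
  have i6 := (Complex.re_le_norm _).trans hmain
  have i7 := congrArg Complex.re hzero
  have sym : ∀ f g : L2, (inner ℂ f g : ℂ).re = (inner ℂ g f : ℂ).re := fun f g =>
    inner_re_symm (𝕜 := ℂ) f g
  -- Under the real part each inner product equals its swapped form, which accounts for the factors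
  -- 2; only the term with `w'` occurs once.
  have hexp : energyDeriv p w u v w' (mop k (Dx v) + F₁)
      (mop k (mulL2 (fun x => 1 + w x) (Dx u)) + F₂ + G)
      = 2 * (inner ℂ (mop p u) (mop p (mop k (Dx v))) + inner ℂ (mop p (mop k (Dx u))) (mop p v) : ℂ).re
      + 2 * (inner ℂ (mulCLM w (mop p u)) (mop p (mop k (Dx v)))
        + inner ℂ (mop p (mop k (mulL2 w (Dx u)))) (mop p v) : ℂ).re
      + 2 * (inner ℂ (mop p u) (mop p F₁) : ℂ).re + 2 * (inner ℂ (mulCLM w (mop p u)) (mop p F₁) : ℂ).re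
      + (inner ℂ (mulCLM w' (mop p u)) (mop p u) : ℂ).re
      + 2 * (inner ℂ (mop p v) (mop p F₂) : ℂ).re + 2 * (inner ℂ (mop p v) (mop p G) : ℂ).re := by
    rw [mulL2_one_add hwb, energyDeriv]
    simp only [map_add, inner_add_left, inner_add_right, Complex.add_re]
    rw [inner_mulCLM_comm hwb hr (mop p (mop k (Dx v))), inner_mulCLM_comm hwb hr (mop p F₁),
      sym (mop p (mop k (Dx v))) (mop p u), sym (mop p F₁) (mop p u),
      sym (mop p (mop k (Dx v))) (mulCLM w _), sym (mop p F₁) (mulCLM w _),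
      sym (mop p v) (mop p (mop k (Dx u))), sym (mop p v) (mop p (mop k (mulL2 w (Dx u)))),
      sym (mop p F₂) (mop p v), sym (mop p G) (mop p v)]
    ring
  rw [hexp, i7, Complex.zero_re]
  rw [enConst, ← hκ]
  exact energyDeriv_arith hS.le hM hM' hκ0 hR a0 b0 f10 f20 hwR i6 i1 i2 i3 i4 i5

/-! ### Suprema in time and removal of the truncation. -/

theorem MemX.continuousOn {s T : ℝ} {f : ℝ → L2} (h : MemX s T f) :
    ContinuousOn (fun t => hsNorm s (f t)) (Icc 0 T) := by
  intro t ht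
  rw [ContinuousWithinAt, tendsto_iff_norm_sub_tendsto_zero]
  refine squeeze_zero' (Eventually.of_forall fun _ => norm_nonneg _) ?_ (h.2 t ht)
  filter_upwards [self_mem_nhdsWithin] with τ hτ
  exact abs_hsNorm_sub_le (h.1 τ hτ) (h.1 t ht)

theorem MemX.le_xNorm {s T : ℝ} {f : ℝ → L2} (h : MemX s T f) {t : ℝ} (ht : t ∈ Icc 0 T) :
    hsNorm s (f t) ≤ xNorm s T f :=
  le_csSup (isCompact_Icc.image_of_continuousOn h.continuousOn).bddAbove (mem_image_of_mem _ ht)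

theorem xNorm_nonneg (s T : ℝ) (f : ℝ → L2) : 0 ≤ xNorm s T f :=
  Real.sSup_nonneg (by rintro _ ⟨t, _, rfl⟩; exact hsNorm_nonneg _ _)

/-- Dominated convergence: at each frequency the truncation is eventually inactive, and the full
weight dominates. -/
theorem tendsto_norm_mop {s : ℝ} {f : L2} (h : MemHs s f) :
    Tendsto (fun n : ℕ => 2 * Real.pi * ‖mop (fun x => min (wt s x) n) f‖ ^ 2) atTop
      (𝓝 (hsNorm s f ^ 2)) := by
  rw [hsNorm_sq]
  refine Tendsto.const_mul _ ?_
  have hm := (memHs_iff s f).1 h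
  have e : ∀ n : ℕ, ‖mop (fun x => min (wt s x) n) f‖ ^ 2
      = ∫ η, (min (wt s η) n * ‖(𝓕 f : L2) η‖) ^ 2 := by
    intro n
    rw [← Lp.norm_fourier_eq, norm_sq_eq_integral]
    refine integral_congr_ae ?_
    filter_upwards [(isTruncWt_min s n.cast_nonneg).fourier_mop f] with x hx
    rw [hx, norm_mul, Complex.norm_real, Real.norm_of_nonneg
      ((isTruncWt_min s n.cast_nonneg).nonneg x)]
  simp only [e]
  refine tendsto_integral_of_dominated_convergence (fun η => ‖wfun s f η‖ ^ 2) ?_ ?_ ?_ ?_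
  · intro n
    exact ((((continuous_wt s).min continuous_const).aestronglyMeasurable).mul
      (Lp.aestronglyMeasurable _).norm).pow 2
  · exact hm.integrable_norm_pow two_ne_zero
  · intro n
    refine Eventually.of_forall fun x => ?_
    have h0 : 0 ≤ min (wt s x) (n : ℝ) := le_min (wt_pos s x).le n.cast_nonneg
    rw [Real.norm_of_nonneg (sq_nonneg _), norm_wfun]
    gcongr
    exact min_le_left _ _
  · refine Eventually.of_forall fun x => ?_
    refine tendsto_const_nhds.congr' ?_
    filter_upwards [eventually_ge_atTop ⌈wt s x⌉₊] with n hn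
    rw [min_eq_left (Nat.ceil_le.1 hn), norm_wfun]

/-! ### Grönwall's inequality. -/

/-- A quadratic Grönwall inequality. -/
theorem gronwall_sq {y : ℝ → ℝ} (hy : Continuous y) (hy0 : ∀ t, 0 ≤ y t) {F D T : ℝ} (hF : 0 ≤ F)
    (hD : 1 ≤ D)
    (h : ∀ t ∈ Icc 0 T, y t ^ 2 ≤ D * (y 0 ^ 2 + ∫ τ in (0 : ℝ)..t, (y τ ^ 2 + y τ * F))) :
    ∀ t ∈ Icc 0 T, y t ≤ D * y 0 * Real.exp (D * t) + D * F * (Real.exp (D * t) - 1) := by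
  have key : ∀ δ > 0, ∀ t ∈ Icc 0 T,
      y t ≤ (D * y 0 + δ) * Real.exp (D * t) + F * (Real.exp (D * t) - 1) := by
    intro δ hδ t ht
    -- The barrier solves b' = D(b + F), so b² grows at rate 2Db(b + F), twice what y ≤ b allows for
    -- the right-hand side of `h`. The shift δ keeps b positive, hence the comparison strict.
    set b : ℝ → ℝ := fun t => (D * y 0 + δ) * Real.exp (D * t) + F * (Real.exp (D * t) - 1) with hb
    have hDy : 0 ≤ D * y 0 := mul_nonneg (by linarith) (hy0 0)
    have hbpos : ∀ t, 0 ≤ t → 0 < b t := by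
      intro t ht
      have h1 : 1 ≤ Real.exp (D * t) := Real.one_le_exp (by positivity)
      have h2 : 0 ≤ F * (Real.exp (D * t) - 1) := mul_nonneg hF (by linarith)
      have h3 : 0 < (D * y 0 + δ) * Real.exp (D * t) := by positivity
      simp only [hb]; linarith
    have hcont : Continuous fun τ => y τ ^ 2 + y τ * F := by fun_prop
    have hZ : ∀ t, HasDerivAt (fun t => D * (y 0 ^ 2 + ∫ τ in (0 : ℝ)..t, (y τ ^ 2 + y τ * F)))
        (D * (y t ^ 2 + y t * F)) t := fun t =>
      ((hcont.integral_hasStrictDerivAt 0 t).hasDerivAt.const_add _).const_mul D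
    have hb' : ∀ t, HasDerivAt b (D * (b t + F)) t := by
      intro t
      have h1 : HasDerivAt (fun t => Real.exp (D * t)) (Real.exp (D * t) * D) t := by
        simpa using ((hasDerivAt_id t).const_mul D).exp
      have h2 := (h1.const_mul (D * y 0 + δ)).add ((h1.sub_const 1).const_mul F)
      convert! h2 using 1
      simp only [hb]; ring
    have hbb : ∀ t, HasDerivAt (fun t => b t ^ 2) (2 * b t * (D * (b t + F))) t := by
      intro t
      simpa using (hb' t).fun_pow 2
    have hle := image_le_of_deriv_right_lt_deriv_boundary
      (f := fun t => D * (y 0 ^ 2 + ∫ τ in (0 : ℝ)..t, (y τ ^ 2 + y τ * F)))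
      (f' := fun t => D * (y t ^ 2 + y t * F)) (a := 0) (b := T) (B := fun t => b t ^ 2)
      (B' := fun t => 2 * b t * (D * (b t + F)))
      (fun t _ => (hZ t).continuousAt.continuousWithinAt) (fun t _ => (hZ t).hasDerivWithinAt)
      (by
        have e : b 0 = D * y 0 + δ := by simp [hb]
        simp only [intervalIntegral.integral_same, add_zero, e]
        -- Here `1 ≤ D` is needed.
        have : D * y 0 ^ 2 ≤ (D * y 0) ^ 2 := by
          rw [mul_pow]; gcongr; nlinarith
        nlinarith)
      hbb
      (by
        intro t ht heq
        have hyb : y t ≤ b t := by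
          refine le_of_sq_le_sq ?_ (hbpos t ht.1).le
          exact (h t ⟨ht.1, ht.2.le⟩).trans_eq heq
        have hbp := hbpos t ht.1
        have h1 : y t ^ 2 + y t * F ≤ b t * (b t + F) := by
          have := hy0 t
          nlinarith [mul_le_mul hyb hyb this hbp.le]
        have h2 : 0 < b t * (b t + F) := by positivity
        nlinarith) ht
    exact le_of_sq_le_sq ((h t ht).trans hle) (hbpos t ht.1).le
  intro t ht
  have hlim : Tendsto (fun δ : ℝ => (D * y 0 + δ) * Real.exp (D * t) + F * (Real.exp (D * t) - 1))
      (𝓝[>] 0) (𝓝 ((D * y 0 + 0) * Real.exp (D * t) + F * (Real.exp (D * t) - 1))) :=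
    (Continuous.tendsto (by fun_prop) 0).mono_left nhdsWithin_le_nhds
  have h1 := ge_of_tendsto hlim (by
    filter_upwards [self_mem_nhdsWithin] with δ hδ
    exact key δ hδ t ht)
  rw [add_zero] at h1
  have h2 : 1 ≤ Real.exp (D * t) := Real.one_le_exp (mul_nonneg (by linarith) ht.1)
  have h3 : F * (Real.exp (D * t) - 1) ≤ D * F * (Real.exp (D * t) - 1) := by
    have : F ≤ D * F := by nlinarith
    gcongr
  linarith

/-! ### The a priori estimate. -/

/-- The constant of the a priori estimate. -/
noncomputable def aprioriConst (s c B A R : ℝ) : ℝ :=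
  4 * Real.pi / min c 1 * (1 + sobConst s * R + enConst s B A R)

theorem enConst_nonneg {s B A R : ℝ} (hs : 1 ≤ s) (hR : 0 ≤ R) : 0 ≤ enConst s B A R := by
  have := sobConst_nonneg s
  have := sobConst_nonneg (s - 1)
  have := symConst_pos hs
  unfold enConst
  positivity

theorem one_le_aprioriConst {s c B A R : ℝ} (hs : 1 ≤ s) (hc : 0 < c) (hR : 0 ≤ R) :
    1 ≤ aprioriConst s c B A R := by
  have h1 := enConst_nonneg (B := B) (A := A) hs hR
  have h2 := mul_nonneg (sobConst_nonneg s) hR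
  have h3 : 0 < min c 1 := lt_min hc one_pos
  have h4 : 1 ≤ 4 * Real.pi / min c 1 := by
    rw [one_le_div h3]
    linarith [min_le_right c 1, Real.pi_gt_three]
  unfold aprioriConst
  nlinarith

/-- The energy is compared with the primitive of its derivative bound. The right side contains only
full `H^s` norms, so it is the same for every truncation `p`. -/
theorem energy_integral_le {s c B A R T F : ℝ} (hs : 3 / 2 < s) (hR : 0 ≤ R) {k : ℝ → ℝ}
    (hk : BddBy (fun η => (k η : ℂ)) (Real.sqrt B)) {w w' u v F₁ F₂ G : ℝ → L2}
    (hw : MemX s T w) (hwd : HasTimeDeriv (s - 1) T w w')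
    (hwr : ∀ t ∈ Icc 0 T, ∀ᵐ x : ℝ, (w t x).im = 0 ∧ c ≤ 1 + (w t x).re)
    (hwR : ∀ t ∈ Icc 0 T, hsNorm s (w t) ≤ R) (hwR' : ∀ t ∈ Icc 0 T, hsNorm (s - 1) (w' t) ≤ R)
    (hu : MemX s T u) (hv : MemX s T v) (hF₁ : MemX s T F₁) (hF₂ : MemX s T F₂)
    (hF : ∀ t ∈ Icc 0 T, hsNorm s (F₁ t) + hsNorm s (F₂ t) ≤ F)
    (hG : ∀ t ∈ Icc 0 T, MemHs s (G t) ∧ hsNorm s (G t) ≤ A * hsNorm s (u t))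
    (hut : HasTimeDeriv (s - 1) T u (fun t => mop k (Dx (v t)) + F₁ t))
    (hvt : HasTimeDeriv (s - 1) T v
      (fun t => mop k (mulL2 (fun x => 1 + w t x) (Dx (u t))) + F₂ t + G t))
    {y : ℝ → ℝ} (hy : Continuous y) (hyt : ∀ t ∈ Icc 0 T, y t = hsNorm s (u t) + hsNorm s (v t))
    {p : ℝ → ℝ} (hp : IsTruncWt s p) {t : ℝ} (ht : t ∈ Icc 0 T) :
    min c 1 * (‖mop p (u t)‖ ^ 2 + ‖mop p (v t)‖ ^ 2) ≤
      (1 + sobConst s * R) * y 0 ^ 2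
        + enConst s B A R * ∫ τ in (0 : ℝ)..t, (y τ ^ 2 + y τ * F) := by
  have h0 : (0 : ℝ) ∈ Icc 0 T := ⟨le_rfl, ht.1.trans ht.2⟩
  have hC := enConst_nonneg (B := B) (A := A) (by linarith : 1 ≤ s) hR
  have hbd : ∀ τ ∈ Icc 0 T, BddBy (w τ) (sobConst s * R) := by
    intro τ hτ
    have h := (hw.1 τ hτ).bddBy (by linarith)
    exact ⟨h.1, h.2.mono fun x hx => hx.trans
      (mul_le_mul_of_nonneg_left (hwR τ hτ) (sobConst_nonneg s))⟩
  have hE : ∀ τ ∈ Icc 0 T, HasDerivWithinAt (fun τ => energy p (w τ) (u τ) (v τ))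
      (energyDeriv p (w τ) (u τ) (v τ) (w' τ) (mop k (Dx (v τ)) + F₁ τ)
        (mop k (mulL2 (fun x => 1 + w τ x) (Dx (u τ))) + F₂ τ + G τ)) (Icc 0 T) τ := fun τ hτ =>
    hasDerivWithinAt_energy p (hwd.hasDerivWithinAt_mulCLM (by linarith) hτ)
      (hut.hasDerivWithinAt (by linarith) hτ) (hvt.hasDerivWithinAt (by linarith) hτ)
  have hcont : Continuous fun τ => y τ ^ 2 + y τ * F := by fun_prop
  have hB : ∀ τ, HasDerivAt (fun t => (1 + sobConst s * R) * y 0 ^ 2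
        + enConst s B A R * ∫ τ in (0 : ℝ)..t, (y τ ^ 2 + y τ * F))
      (enConst s B A R * (y τ ^ 2 + y τ * F)) τ := fun τ =>
    ((hcont.integral_hasStrictDerivAt 0 τ).hasDerivAt.const_mul _).const_add _
  refine (le_energy (hbd t ht) (hwr t ht)).trans ?_
  refine image_le_of_deriv_right_le_deriv_boundary
    (f := fun τ => energy p (w τ) (u τ) (v τ)) (a := 0) (b := T)
    (fun τ hτ => (hE τ hτ).continuousWithinAt)
    (fun τ hτ => (hE τ ⟨hτ.1, hτ.2.le⟩).mono_of_mem_nhdsWithin (Icc_mem_nhdsGE_of_mem hτ))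
    ?_ (fun τ _ => (hB τ).continuousAt.continuousWithinAt) (fun τ _ => (hB τ).hasDerivWithinAt)
    ?_ ht
  · simp only [intervalIntegral.integral_same, mul_zero, add_zero]
    rw [hyt 0 h0]
    exact energy_le hp (mul_nonneg (sobConst_nonneg s) hR) (hbd 0 h0) (hu.1 0 h0) (hv.1 0 h0)
  · intro τ hτ'
    have hτ : τ ∈ Icc 0 T := ⟨hτ'.1, hτ'.2.le⟩
    have h := energyDeriv_le (A := A) hs hR rfl hp hk (hw.1 τ hτ) (hwd.1 τ hτ).2 (hu.1 τ hτ)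
      (hv.1 τ hτ) (hF₁.1 τ hτ) (hF₂.1 τ hτ) (hG τ hτ).1 ((hwr τ hτ).mono fun x hx => hx.1)
      (hwR τ hτ) (hwR' τ hτ) (hG τ hτ).2
    refine h.trans ?_
    rw [← hyt τ hτ]
    have hy0 : 0 ≤ y τ := by
      rw [hyt τ hτ]; exact add_nonneg (hsNorm_nonneg _ _) (hsNorm_nonneg _ _)
    have := hF τ hτ
    gcongr

/-- The a priori estimate for the linear system. -/
theorem hsNorm_add_hsNorm_le {s c B A R T F : ℝ} (hs : 3 / 2 < s) (hc : 0 < c) (hR : 0 ≤ R)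
    {k : ℝ → ℝ} (hk : BddBy (fun η => (k η : ℂ)) (Real.sqrt B)) {w w' u v F₁ F₂ G : ℝ → L2}
    (hw : MemX s T w) (hwd : HasTimeDeriv (s - 1) T w w')
    (hwr : ∀ t ∈ Icc 0 T, ∀ᵐ x : ℝ, (w t x).im = 0 ∧ c ≤ 1 + (w t x).re)
    (hwR : ∀ t ∈ Icc 0 T, hsNorm s (w t) ≤ R) (hwR' : ∀ t ∈ Icc 0 T, hsNorm (s - 1) (w' t) ≤ R)
    (hu : MemX s T u) (hv : MemX s T v) (hF₁ : MemX s T F₁) (hF₂ : MemX s T F₂)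
    (hF : ∀ t ∈ Icc 0 T, hsNorm s (F₁ t) + hsNorm s (F₂ t) ≤ F)
    (hG : ∀ t ∈ Icc 0 T, MemHs s (G t) ∧ hsNorm s (G t) ≤ A * hsNorm s (u t))
    (hut : HasTimeDeriv (s - 1) T u (fun t => mop k (Dx (v t)) + F₁ t))
    (hvt : HasTimeDeriv (s - 1) T v
      (fun t => mop k (mulL2 (fun x => 1 + w t x) (Dx (u t))) + F₂ t + G t))
    {t : ℝ} (ht : t ∈ Icc 0 T) :
    hsNorm s (u t) + hsNorm s (v t) ≤
      aprioriConst s c B A R * (hsNorm s (u 0) + hsNorm s (v 0))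
          * Real.exp (aprioriConst s c B A R * t)
        + aprioriConst s c B A R * F * (Real.exp (aprioriConst s c B A R * t) - 1) := by
  have hT : 0 ≤ T := ht.1.trans ht.2
  have h0 : (0 : ℝ) ∈ Icc 0 T := ⟨le_rfl, hT⟩
  -- The constant extension beyond [0,T] is continuous on ℝ, so the primitive is differentiable at
  -- every point.
  set y : ℝ → ℝ := IccExtend hT ((Icc 0 T).domRestrict fun t => hsNorm s (u t) + hsNorm s (v t)) with hy
  have hyc : Continuous y :=
    (continuousOn_iff_continuous_domRestrict.1 (hu.continuousOn.add hv.continuousOn)).Icc_extend'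
  have hyt : ∀ t ∈ Icc 0 T, y t = hsNorm s (u t) + hsNorm s (v t) := fun t ht => by
    rw [hy, IccExtend_of_mem hT _ ht]; rfl
  have hy0 : ∀ t, 0 ≤ y t := fun t => add_nonneg (hsNorm_nonneg _ _) (hsNorm_nonneg _ _)
  have hF0 : 0 ≤ F := (add_nonneg (hsNorm_nonneg _ _) (hsNorm_nonneg _ _)).trans (hF 0 h0)
  rw [← hyt t ht, ← hyt 0 h0]
  refine gronwall_sq hyc hy0 hF0 (one_le_aprioriConst (by linarith) hc hR) ?_ t ht
  intro t ht
  have hcpos : 0 < min c 1 := lt_min hc one_pos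
  have hlim := (((tendsto_norm_mop (hu.1 t ht)).add (tendsto_norm_mop (hv.1 t ht))).const_mul
    (min c 1))
  have hle := le_of_tendsto' hlim (b := 2 * Real.pi * ((1 + sobConst s * R) * y 0 ^ 2
        + enConst s B A R * ∫ τ in (0 : ℝ)..t, (y τ ^ 2 + y τ * F))) (by
    intro n
    have h := energy_integral_le hs hR hk hw hwd hwr hwR hwR' hu hv hF₁ hF₂ hF hG hut hvt hyc hyt
      (isTruncWt_min s n.cast_nonneg) ht
    have h2 := mul_le_mul_of_nonneg_left h (by positivity : 0 ≤ 2 * Real.pi)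
    linarith)
  have hI : 0 ≤ ∫ τ in (0 : ℝ)..t, (y τ ^ 2 + y τ * F) :=
    intervalIntegral.integral_nonneg ht.1 fun τ _ =>
      add_nonneg (sq_nonneg _) (mul_nonneg (hy0 τ) hF0)
  have hE := enConst_nonneg (B := B) (A := A) (by linarith : 1 ≤ s) hR
  have hM := mul_nonneg (sobConst_nonneg s) hR
  generalize (∫ τ in (0 : ℝ)..t, (y τ ^ 2 + y τ * F)) = I at hle hI ⊢
  -- The factor 4π in the constant is 2π from the normalization of the transform times 2 from (a +
  -- b)² ≤ 2(a² + b²).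
  rw [hyt t ht, aprioriConst, div_mul_eq_mul_div, div_mul_eq_mul_div, le_div_iff₀ hcpos]
  have h3 : (hsNorm s (u t) + hsNorm s (v t)) ^ 2 ≤ 2 * (hsNorm s (u t) ^ 2 + hsNorm s (v t) ^ 2) := by
    nlinarith [sq_nonneg (hsNorm s (u t) - hsNorm s (v t))]
  have h4 : (1 + sobConst s * R) * y 0 ^ 2 + enConst s B A R * I
      ≤ (1 + sobConst s * R + enConst s B A R) * (y 0 ^ 2 + I) := by
    nlinarith [mul_nonneg hE (sq_nonneg (y 0)), mul_nonneg hM hI]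
  have h5 := mul_le_mul_of_nonneg_left h4 (by positivity : 0 ≤ 4 * Real.pi)
  have h6 := mul_le_mul_of_nonneg_left h3 hcpos.le
  linarith

end NonlocalWave

theorem lemma2p2 (s c₁ B A R : ℝ) (hs : 3 / 2 < s) (hc₁ : 0 < c₁) :
    -- the constant depends on `s`, `c₁`, the bound `B` for `β̂`, the constant `A` in the
    -- hypothesis on `G`, and a bound `R` for the norm of `w`, and on nothing else
    ∃ C : ℝ, 0 < C ∧
      ∀ (β : 𝓢'(ℝ, ℂ)) (b : ℝ → ℝ), NonlocalWave.HasFourierTransform β b → Measurable b →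
        (∀ ξ, 0 ≤ b ξ ∧ b ξ ≤ B) →
      ∀ T : ℝ, 0 < T →
      ∀ w w' : ℝ → NonlocalWave.L2,
        NonlocalWave.MemY s (s - 1) T w w' →
        (∀ t ∈ Set.Icc 0 T, ∀ᵐ x : ℝ, (w t x).im = 0 ∧ c₁ ≤ 1 + (w t x).re) →
        NonlocalWave.yNorm s (s - 1) T w w' ≤ R →
      ∀ (u₀ v₀ : NonlocalWave.L2) (u v F₁ F₂ G : ℝ → NonlocalWave.L2),
        NonlocalWave.MemHs s u₀ → NonlocalWave.MemHs s v₀ →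
        NonlocalWave.MemX s T u → NonlocalWave.MemX s T v →
        NonlocalWave.MemX s T F₁ → NonlocalWave.MemX s T F₂ →
        (∀ t ∈ Set.Icc 0 T, NonlocalWave.MemHs s (G t) ∧
          NonlocalWave.hsNorm s (G t) ≤ A * NonlocalWave.hsNorm s (u t)) →
        -- `u_t = K v_x + F₁`, `u(0) = u₀`
        NonlocalWave.HasTimeDeriv (s - 1) T u
          (fun t => NonlocalWave.K b (NonlocalWave.Dx (v t)) + F₁ t) → u 0 = u₀ →
        -- `v_t = K ((1 + w) u_x) + F₂ + G`, `v(0) = v₀`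
        NonlocalWave.HasTimeDeriv (s - 1) T v
          (fun t => NonlocalWave.K b
            (NonlocalWave.mulL2 (fun x => 1 + w t x) (NonlocalWave.Dx (u t))) + F₂ t + G t) →
        v 0 = v₀ →
      ∀ t ∈ Set.Icc 0 T,
        NonlocalWave.hsNorm s (u t) + NonlocalWave.hsNorm s (v t) ≤
          C * (NonlocalWave.hsNorm s u₀ + NonlocalWave.hsNorm s v₀) * Real.exp (C * t) +
          C * (NonlocalWave.xNorm s T F₁ + NonlocalWave.xNorm s T F₂) *
            (Real.exp (C * t) - 1) := by
  -- The absolute value keeps the constant positive when `R` is negative, and it is still an upper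
  -- bound for the norm of `w`.
  refine ⟨NonlocalWave.aprioriConst s c₁ B A |R|, zero_lt_one.trans_le
    (NonlocalWave.one_le_aprioriConst (by linarith) hc₁ (abs_nonneg R)), ?_⟩
  rintro β b - hb hbB T hT w w' ⟨hw, hwd, hw'⟩ hwr hwR u₀ v₀ u v F₁ F₂ G - - hu hv hF₁ hF₂ hG
    hut rfl hvt rfl t ht
  have hk := NonlocalWave.bddBy_sqrt hb hbB
  simp only [NonlocalWave.K_eq_mop hk] at hut hvt
  have h1 := NonlocalWave.xNorm_nonneg s T w
  have h2 := NonlocalWave.xNorm_nonneg (s - 1) T w'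
  have h3 := le_abs_self R
  rw [NonlocalWave.yNorm] at hwR
  exact NonlocalWave.hsNorm_add_hsNorm_le hs hc₁ (abs_nonneg R) hk hw hwd hwr
    (fun t ht => (hw.le_xNorm ht).trans (by linarith))
    (fun t ht => (hw'.le_xNorm ht).trans (by linarith)) hu hv hF₁ hF₂
    (fun t ht => add_le_add (hF₁.le_xNorm ht) (hF₂.le_xNorm ht)) hG hut hvt ht
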